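/- **Model.** The state $\theta\in[0,1]$ has a prior $F$ with mean $\mu$, a strictly positive density, and a strictly log-concave cdf. A sender privately chooses a signal about $\theta$, whose realizations are labelled by the posterior mean they induce, $x=\mathbb{E}[\theta\mid x]$; let $G$ be the induced distribution of posterior means. The signal costs $\kappa\int c\,dG$, where $c$ is twice differentiable, strictly convex and bounded on $(0,1)$ with $c(\mu)=0$. After seeing $x$ the sender either has $x$ certified, at cost $\gamma$, or sends the message $m_\varnothing$ (possibly mixing). The receiver observes only the message (a certified $x$, or $m_\varnothing$), not the signal, and takes an action $a\in[0,1]$. The sender's payoff is $a$ minus the certification and information costs; the receiver's payoff is $-(a-\theta)^2$. A *covert equilibrium* consists of the sender's strategy (signal and certification rule), the receiver's strategy and the receiver's beliefs (posterior means of the state) such that: the receiver's belief after a certified $x$ is $x$; the belief after $m_\varnothing$ is $\mathbb{E}[\theta\mid m_\varnothing]$ under the sender's strategy if $m_\varnothing$ has positive probability, and is an arbitrary number in $[0,1]$ otherwise; the action equals the belief; and the sender's strategy maximizes her expected payoff over all signals and certification rules, the receiver's strategy being fixed. A *free-learning equilibrium* is a covert equilibrium for $\kappa=0$; it is *Pareto-worst*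 if both players' payoffs in it are at most their payoffs in every other free-learning equilibrium. **Theorem.** Let $\gamma\in(0,1-\mu)$. There is a unique $\alpha^*\in[0,1]$ with $\alpha^*=\mathbb{E}[\theta\mid\theta\le\alpha^*+\gamma]$; put $x^*=\alpha^*+\gamma$. Then $\alpha^*\in(0,1)$, $x^*<1$, and the following hold. 1. There is a Pareto-worst free-learning equilibrium in which the sender learns only whether $\theta\ge x^*$ (so her posterior mean is $\mathbb{E}[\theta\mid\theta\ge x^*]$ if $\theta\ge x^*$ and $\alpha^*$ if $\theta<x^*$), certifies a posterior mean $x$ if and only if $x\ge x^*$, and the belief after $m_\varnothing$ is $\alpha^*$. Every Pareto-worst free-learning equilibrium coincides with it up to the distribution of the posterior means that are not certified: its belief after $m_\varnothing$ is $\alpha^*$ and, almost surely, there is certification if and only if $\theta\ge x^*$, the certified posterior mean being $\mathbb{E}[\theta\mid\theta\ge x^*]$. 2. For every sequence $\kappa_n>0$ with $\kappa_n\to0$ and every sequence of covert equilibria for the cost scales $\kappa_n$, the equilibria converge to the equilibrium described in 1: the joint law of the state, the posterior mean and the certification decision converges weakly to its joint law in that equilibrium, and the belief and the action after $m_\varnothing$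 converge to $\alpha^*$. -/

import Mathlib

open MeasureTheory ProbabilityTheory Filter Topology Set

noncomputable section

namespace Evidence

/-- The prior: a probability distribution on `[0,1]` with a strictly positive density and a
strictly log-concave cdf. -/
structure IsPrior (F : Measure ℝ) : Prop where
  prob : IsProbabilityMeasure F
  density : ∃ f : ℝ → ℝ, Measurable f ∧ (∀ x ∈ Ioo (0 : ℝ) 1, 0 < f x) ∧
    F = (volume.restrict (Icc (0 : ℝ) 1)).withDensity (fun x => ENNReal.ofReal (f x))
  logConcave : StrictConcaveOn ℝ (Ioc (0 : ℝ) 1) (fun x => Real.log (cdf F x))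

/-- The prior mean `μ`. -/
def priorMean (F : Measure ℝ) : ℝ := ∫ θ, θ ∂F

/-- The function `c` in the information cost `κ ∫ c dG`, for a prior with mean `m`. -/
structure IsCost (m : ℝ) (c : ℝ → ℝ) : Prop where
  diff : DifferentiableOn ℝ c (Ioo 0 1)
  diff_deriv : DifferentiableOn ℝ (deriv c) (Ioo 0 1)
  strictConvex : StrictConvexOn ℝ (Ioo 0 1) c
  bounded : ∃ B : ℝ, ∀ x ∈ Ioo (0 : ℝ) 1, |c x| ≤ B
  mean_zero : c m = 0

/-- A signal `π : [0,1] → Δ([0,1])` about the state, whose realizations are labelled by the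
posterior mean that they induce: `x = E[θ | x]`. -/
structure Signal (F : Measure ℝ) where
  kernel : Kernel ℝ ℝ
  markov : IsMarkovKernel kernel
  mem_unit : ∀ θ ∈ Icc (0 : ℝ) 1, kernel θ (Icc 0 1)ᶜ = 0
  posterior_mean : ∀ B : Set ℝ, MeasurableSet B →
    ∫ z in {z : ℝ × ℝ | z.2 ∈ B}, z.1 ∂(F ⊗ₘ kernel) =
      ∫ z in {z : ℝ × ℝ | z.2 ∈ B}, z.2 ∂(F ⊗ₘ kernel)

/-- The distribution `G` of posterior means that a signal induces. -/
def Signal.dist {F : Measure ℝ} (σ : Signal F) : Measure ℝ := (F ⊗ₘ σ.kernel).snd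

/-- Joint law of (state `θ`, posterior mean `x`, certified or not), when the posterior mean `x`
is certified with probability `d x {true}` and the message is `m_∅` with probability
`d x {false}`. -/
def outcome {F : Measure ℝ} (σ : Signal F) (d : Kernel ℝ Bool) : Measure (ℝ × ℝ × Bool) :=
  F ⊗ₘ (σ.kernel ⊗ₖ (Kernel.prodMkLeft ℝ d))

/-- Messages: `some x` with `x ∈ [0,1]` is the certified posterior mean `x`, and `none` is `m_∅`. -/
def messages : Set (Option ℝ) := {none} ∪ some '' Icc (0 : ℝ) 1

/-- The message sent, given the posterior mean and whether it is certified. -/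
def message (x : ℝ) (b : Bool) : Option ℝ := if b = true then some x else none

/-- The sender's ex ante payoff, if the receiver answers the message `m` with the action `a m`:
the action, less `γ` if there is certification, less the cost of information. -/
def senderPayoff {F : Measure ℝ} (c : ℝ → ℝ) (γ κ : ℝ) (σ : Signal F) (d : Kernel ℝ Bool)
    (a : Option ℝ → ℝ) : ℝ :=
  (∫ z, (a (message z.2.1 z.2.2) - if z.2.2 = true then γ else 0) ∂(outcome σ d))
    - κ * ∫ x, c x ∂σ.dist

/-- The receiver's ex ante payoff: quadratic loss. -/
def receiverPayoff {F : Measure ℝ} (σ : Signal F) (d : Kernel ℝ Bool) (a : Option ℝ → ℝ) : ℝ :=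
  ∫ z, -(a (message z.2.1 z.2.2) - z.1) ^ 2 ∂(outcome σ d)

/-- Strategies and beliefs in the covert game. The receiver observes the message only, so his
action and his belief (a posterior mean of the state) are functions of the message. -/
structure Assessment (F : Measure ℝ) where
  signal : Signal F
  certify : Kernel ℝ Bool
  markov : IsMarkovKernel certify
  action : Option ℝ → ℝ
  belief : Option ℝ → ℝ

/-- Joint law of (state, posterior mean, certified or not) along the path of play. -/
def Assessment.law {F : Measure ℝ} (e : Assessment F) : Measure (ℝ × ℝ × Bool) :=
  outcome e.signal e.certify

theorem Assessment.isProbabilityMeasure_law {F : Measure ℝ} (hF : IsPrior F) (e : Assessment F) :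
    IsProbabilityMeasure e.law := by
  have := hF.prob
  have := e.markov
  have := e.signal.markov
  unfold Assessment.law outcome
  infer_instance

/-- The same law as a point of the space of probability measures, with the weak topology. -/
def Assessment.lawP {F : Measure ℝ} (hF : IsPrior F) (e : Assessment F) :
    ProbabilityMeasure (ℝ × ℝ × Bool) :=
  ⟨e.law, e.isProbabilityMeasure_law hF⟩

/-- The event that the message is `m_∅`. -/
def noCert : Set (ℝ × ℝ × Bool) := {z | z.2.2 = false}

/-- Covert (perfect Bayesian) equilibrium, with certification cost `γ` and information cost
`κ ∫ c dG`. Off the path, the belief after `m_∅` is an arbitrary number in `[0,1]`. -/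
structure IsCovertEquilibrium {F : Measure ℝ} (c : ℝ → ℝ) (γ κ : ℝ) (e : Assessment F) :
    Prop where
  belief_mem : ∀ m ∈ messages, e.belief m ∈ Icc (0 : ℝ) 1
  belief_cert : ∀ x ∈ Icc (0 : ℝ) 1, e.belief (some x) = x
  belief_noCert : e.law noCert ≠ 0 → e.belief none = ∫ z, z.1 ∂(ProbabilityTheory.cond e.law noCert)
  action_eq : ∀ m ∈ messages, e.action m = e.belief m
  optimal : ∀ (σ : Signal F) (d : Kernel ℝ Bool), IsMarkovKernel d →
    senderPayoff c γ κ σ d e.action ≤ senderPayoff c γ κ e.signal e.certify e.action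

/-- A Pareto-worst free-learning equilibrium: a covert equilibrium for `κ = 0` in which both
players get at most what they get in any other covert equilibrium for `κ = 0`. -/
def IsParetoWorstFree {F : Measure ℝ} (c : ℝ → ℝ) (γ : ℝ) (e : Assessment F) : Prop :=
  IsCovertEquilibrium c γ 0 e ∧
    ∀ e' : Assessment F, IsCovertEquilibrium c γ 0 e' →
      senderPayoff c γ 0 e.signal e.certify e.action ≤
          senderPayoff c γ 0 e'.signal e'.certify e'.action ∧
        receiverPayoff e.signal e.certify e.action ≤
          receiverPayoff e'.signal e'.certify e'.action

/-- `E_F[θ | θ ∈ A]`. -/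
def condMean (F : Measure ℝ) (A : Set ℝ) : ℝ := ∫ θ, θ ∂(ProbabilityTheory.cond F A)

end Evidence

end

/-! Fix the action `α` after `m_∅`. Certification depends on the state only through the posterior
mean, so in expectation a certified posterior mean may be replaced by the state itself. The sender's
payoff thus becomes `E max(α, θ - γ)` minus `E loss` minus the information cost. The loss is
nonnegative, and it equals `|θ - (α + γ)|` where the decision differs from the full-information one
(certify iff `θ ≥ α + γ`) and `0` elsewhere.

A deviation to full information is not observed, so `E loss ≤ κ (∫ c dF - ∫ c dG) ≤ 2Bκ` in
equilibrium. The prior has no atoms, so Markov's inequality turns this into a bound on the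
probability of a wrong decision: it is zero if `κ = 0` and vanishes as `κ → 0`. Consistency of the
belief after `m_∅` then says that, up to this probability, `S(α + γ) = γ F(α + γ)`, where `S(s) = E
(s - θ)⁺` is `shortfall` and `F` also denotes the cdf. Since `S(s) = ∫₀ˢ F(s - u) du`, log-concavity
makes `S / F` strictly increasing on `(0, 1]`; the condition `γ < 1 - μ` excludes cutoffs from `1`
on. Hence there is exactly one solution `α*`.

All free-learning equilibria therefore share the belief, the certified states and the sender's
payoff. The receiver's payoff varies only through the dispersion of certified posterior means around
`E[θ | θ ≥ x*]`, which is zero exactly in the binary equilibrium; this makes it Pareto-worst and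
gives uniqueness.

If `κ > 0`, strict convexity of `c` makes any information beyond the decision a waste, so the
posterior mean is a function of the decision (`IsCovertEquilibrium.posterior_eq`). As `κ → 0`,
compactness and uniqueness give convergence of the belief; the decisions approach the cutoff rule,
the two posterior means converge, and the joint laws converge weakly. -/

namespace Evidence

/-! ### The prior, its cdf, and the threshold equation -/

section Prior

variable {F : Measure ℝ}

theorem IsPrior.absolutelyContinuous (hF : IsPrior F) : F ≪ volume := by
  obtain ⟨f, -, -, rfl⟩ := hF.density
  exact (withDensity_absolutelyContinuous _ _).trans
    (Measure.absolutelyContinuous_of_le Measure.restrict_le_self)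

theorem IsPrior.nullSingletonClass (hF : IsPrior F) : NullSingletonClass F :=
  ⟨fun x => hF.absolutelyContinuous (by simp)⟩

theorem IsPrior.ae_mem_Ioo (hF : IsPrior F) : ∀ᵐ θ ∂F, θ ∈ Ioo (0 : ℝ) 1 := by
  obtain ⟨f, -, -, rfl⟩ := hF.density
  refine (withDensity_absolutelyContinuous _ _).ae_le ?_
  rw [restrict_Ioo_eq_restrict_Icc.symm]
  exact ae_restrict_mem measurableSet_Ioo

theorem IsPrior.ae_mem_Icc (hF : IsPrior F) : ∀ᵐ θ ∂F, θ ∈ Icc (0 : ℝ) 1 :=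
  hF.ae_mem_Ioo.mono fun _ h => Ioo_subset_Icc_self h

theorem IsPrior.integrable_of_continuous (hF : IsPrior F) {g : ℝ → ℝ} (hg : Continuous g) :
    Integrable g F := by
  have := hF.prob
  obtain ⟨C, hC⟩ := (isCompact_Icc (a := (0 : ℝ)) (b := 1)).exists_bound_of_continuousOn
    hg.continuousOn
  exact Integrable.of_bound hg.aestronglyMeasurable C (hF.ae_mem_Icc.mono hC)

theorem IsPrior.measure_Ioo_pos (hF : IsPrior F) {a b : ℝ} (ha : 0 ≤ a) (hab : a < b)
    (hb : b ≤ 1) : 0 < F (Ioo a b) := by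
  obtain ⟨f, hf, hpos, rfl⟩ := hF.density
  rw [pos_iff_ne_zero, Ne, withDensity_apply_eq_zero hf.ennreal_ofReal]
  have hsub : Ioo a b ⊆ {x | ENNReal.ofReal (f x) ≠ 0} ∩ Ioo a b := fun x hx =>
    ⟨by simpa using hpos x ⟨ha.trans_lt hx.1, hx.2.trans_le hb⟩, hx⟩
  intro h
  have h' := measure_mono_null hsub h
  rw [Measure.restrict_apply measurableSet_Ioo,
    inter_eq_left.2 (show Ioo a b ⊆ Icc 0 1 from fun x hx => ⟨ha.trans hx.1.le, hx.2.le.trans hb⟩),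
    Real.volume_Ioo] at h'
  simp at h'
  linarith

/-- Absolute continuity of the integral of the density. The radius must not depend on the centre,
because the cutoffs of a sequence of equilibria move. -/
theorem IsPrior.exists_measureReal_ball_lt (hF : IsPrior F) {δ : ℝ} (hδ : 0 < δ) :
    ∃ ε > 0, ∀ s : ℝ, F.real (Metric.ball s ε) < δ := by
  obtain ⟨f, hf, hpos, hFd⟩ := hF.density
  have := hF.prob
  have hfin : ∫⁻ x, ENNReal.ofReal (f x) ∂(volume.restrict (Icc (0 : ℝ) 1)) ≠ ⊤ := by
    have h1 : F univ ≠ ⊤ := measure_ne_top _ _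
    rwa [hFd, withDensity_apply _ MeasurableSet.univ, Measure.restrict_univ] at h1
  obtain ⟨η, hη, h⟩ := exists_pos_setLIntegral_lt_of_measure_lt hfin
    (ε := ENNReal.ofReal δ) (by simpa using hδ)
  obtain ⟨ε, hε, hεη⟩ : ∃ ε : ℝ, 0 < ε ∧ ENNReal.ofReal (2 * ε) < η := by
    rcases eq_or_ne η ⊤ with rfl | hη'
    · exact ⟨1, one_pos, ENNReal.ofReal_lt_top⟩
    · refine ⟨η.toReal / 4, by have := ENNReal.toReal_pos hη.ne' hη'; positivity, ?_⟩
      have := ENNReal.toReal_pos hη.ne' hη'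
      rw [ENNReal.ofReal_lt_iff_lt_toReal (by positivity) hη']
      linarith
  refine ⟨ε, hε, fun s => ?_⟩
  have h2 := h (Metric.ball s ε) ?_
  · rw [← withDensity_apply _ measurableSet_ball, ← hFd] at h2
    rw [measureReal_def]
    exact (ENNReal.lt_ofReal_iff_toReal_lt (measure_ne_top _ _)).1 h2
  · refine lt_of_le_of_lt (Measure.restrict_apply_le _ _) ?_
    rwa [Real.volume_ball]

theorem condMean_eq [IsFiniteMeasure F] (A : Set ℝ) :
    condMean F A = (F.real A)⁻¹ * ∫ θ in A, θ ∂F := by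
  rw [condMean, ProbabilityTheory.cond, integral_smul_measure, ENNReal.toReal_inv,
    smul_eq_mul, measureReal_def]

theorem IsPrior.cdf_pos (hF : IsPrior F) {t : ℝ} (ht : 0 < t) : 0 < cdf F t := by
  have := hF.prob
  rw [cdf_eq_real, measureReal_def]
  refine ENNReal.toReal_pos (ne_of_gt ?_) (measure_ne_top _ _)
  refine (hF.measure_Ioo_pos le_rfl (lt_min ht one_pos) (min_le_right _ _)).trans_le
    (measure_mono fun x hx => ?_)
  exact hx.2.le.trans (min_le_left _ _)

theorem IsPrior.cdf_nonpos (hF : IsPrior F) {t : ℝ} (ht : t ≤ 0) : cdf F t = 0 := by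
  have := hF.prob
  rw [cdf_eq_real, measureReal_def]
  have : F (Iic t) = 0 := by
    refine measure_mono_null ?_ (ae_iff.1 hF.ae_mem_Ioo)
    intro x hx h
    exact absurd (h.1.trans_le hx) (not_lt.2 ht)
  simp [this]

theorem IsPrior.cdf_one_le (hF : IsPrior F) {t : ℝ} (ht : 1 ≤ t) : cdf F t = 1 := by
  have := hF.prob
  rw [cdf_eq_real, measureReal_def]
  have : F (Iic t) = 1 := by
    rw [prob_compl_eq_zero_iff measurableSet_Iic |>.symm]
    refine measure_mono_null ?_ (ae_iff.1 hF.ae_mem_Ioo)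
    intro x hx h
    exact hx (h.2.le.trans ht)
  simp [this]

theorem IsPrior.continuous_cdf (hF : IsPrior F) : Continuous (cdf F) := by
  have := hF.prob
  refine Metric.continuous_iff.2 fun b δ hδ => ?_
  obtain ⟨ε, hε, h⟩ := hF.exists_measureReal_ball_lt hδ
  refine ⟨ε, hε, fun a hab => ?_⟩
  have key : ∀ x y : ℝ, x ≤ y → dist x b < ε → dist y b < ε → cdf F y - cdf F x < δ := by
    intro x y hxy hx hy
    have h1 : F.real (Iic y) ≤ F.real (Iic x) + F.real (Metric.ball b ε) := by
      refine (measureReal_mono ?_).trans (measureReal_union_le _ _)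
      intro z hz
      by_cases hzx : z ≤ x
      · exact Or.inl hzx
      · right
        rw [Metric.mem_ball]
        rw [Real.dist_eq, abs_lt] at *
        have : z ≤ y := hz
        constructor <;> linarith
    rw [cdf_eq_real, cdf_eq_real]
    linarith [h b]
  have hb : dist b b < ε := by simpa using hε
  rw [Real.dist_eq, abs_lt]
  rcases le_total a b with hle | hle
  · have := key a b hle hab hb
    have := monotone_cdf F hle
    constructor <;> linarith
  · have := key b a hle hb hab
    have := monotone_cdf F hle
    constructor <;> linarith

/-- `∫ (s - θ)⁺ dF`. -/
noncomputable def shortfall (F : Measure ℝ) (s : ℝ) : ℝ := ∫ θ, max (s - θ) 0 ∂F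

theorem IsPrior.shortfall_eq_setIntegral (hF : IsPrior F) (s : ℝ) :
    shortfall F s = s * cdf F s - ∫ θ in Iic s, θ ∂F := by
  have := hF.prob
  have h1 : shortfall F s = ∫ θ in Iic s, (s - θ) ∂F := by
    rw [shortfall, ← integral_indicator measurableSet_Iic]
    congr 1; ext θ
    by_cases h : θ ≤ s
    · rw [indicator_of_mem (by exact h), max_eq_left (by linarith)]
    · rw [indicator_of_notMem (by exact h), max_eq_right (by linarith)]
  rw [h1, integral_sub (integrable_const _) (hF.integrable_of_continuous (g := fun θ => θ) (by fun_prop)).integrableOn,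
    cdf_eq_real]
  simp [mul_comm]

theorem IsPrior.continuous_shortfall (hF : IsPrior F) : Continuous (shortfall F) := by
  have := hF.prob
  refine (LipschitzWith.of_dist_le_mul (K := 1) fun x y => ?_).continuous
  rw [Real.dist_eq, shortfall, shortfall, ← integral_sub
    (hF.integrable_of_continuous (by fun_prop)) (hF.integrable_of_continuous (by fun_prop))]
  have h : ∀ θ, ‖max (x - θ) 0 - max (y - θ) 0‖ ≤ |x - y| := fun θ => by
    rw [Real.norm_eq_abs]
    refine (abs_max_sub_max_le_abs _ _ _).trans (le_of_eq ?_)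
    ring_nf
  simpa [Real.dist_eq] using norm_integral_le_of_norm_le_const (μ := F) (ae_of_all _ h)

/-- Layer-cake formula for `(s - θ)⁺`, which lies in `[0, s]` almost surely. -/
theorem IsPrior.shortfall_eq_integral_cdf (hF : IsPrior F) {s : ℝ} (hs : 0 ≤ s) :
    shortfall F s = ∫ u in (0 : ℝ)..s, cdf F (s - u) := by
  have := hF.prob
  have h := (hF.integrable_of_continuous (g := fun θ => max (s - θ) 0)
    (by fun_prop)).integral_eq_integral_Ioc_meas_le (M := s) (ae_of_all _ fun θ => le_max_right _ _)
    (hF.ae_mem_Icc.mono fun θ h => max_le (by linarith [h.1]) hs)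
  rw [shortfall, h, intervalIntegral.integral_of_le hs]
  refine setIntegral_congr_fun measurableSet_Ioc fun t ht => ?_
  simp only [cdf_eq_real]
  congr 1
  ext θ
  simp only [mem_ofPred_eq, le_max_iff, mem_Iic]
  constructor
  · rintro (h | h)
    · linarith
    · linarith [ht.1]
  · intro h; left; linarith

/-- Both `s` and `t - u` lie between `s - u` and `t`, and the two pairs have equal sums, so
concavity of the log of the cdf compares the products. -/
theorem IsPrior.cdf_mul_cdf_le (hF : IsPrior F) {s t u : ℝ} (hst : s < t) (ht : t ≤ 1)
    (hu0 : 0 ≤ u) (hus : u ≤ s) : cdf F (s - u) * cdf F t ≤ cdf F (t - u) * cdf F s := by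
  -- At `u = s` the left point is `0`, outside the range of log-concavity, but the cdf vanishes
  -- there.
  rcases hus.eq_or_lt with rfl | hus
  · rw [sub_self, hF.cdf_nonpos le_rfl, zero_mul]
    exact mul_nonneg (cdf_nonneg _ _) (cdf_nonneg _ _)
  have hconc := hF.logConcave.concaveOn.2
  have hD : 0 < t - s + u := by linarith
  have hx : s - u ∈ Ioc (0 : ℝ) 1 := ⟨by linarith, by linarith⟩
  have hy : t ∈ Ioc (0 : ℝ) 1 := ⟨by linarith, ht⟩
  -- The interval from `s - u` to `t` has length `t - s + u`; these are the barycentric weights of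
  -- `s`, and, swapped, of `t - u`.
  have hw : 0 ≤ u / (t - s + u) := by positivity
  have hw' : 0 ≤ (t - s) / (t - s + u) := div_nonneg (by linarith) hD.le
  have hsum : (t - s) / (t - s + u) + u / (t - s + u) = 1 := by field_simp
  have h1 := hconc hx hy hw' hw hsum
  have h2 := hconc hx hy hw hw' (by rw [add_comm]; exact hsum)
  have e1 : ((t - s) / (t - s + u)) • (s - u) + (u / (t - s + u)) • t = s := by
    simp only [smul_eq_mul]; field_simp; ring
  have e2 : (u / (t - s + u)) • (s - u) + ((t - s) / (t - s + u)) • t = t - u := by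
    simp only [smul_eq_mul]; field_simp; ring
  rw [e1] at h1
  rw [e2] at h2
  simp only [smul_eq_mul] at h1 h2
  have hsum' : (t - s) / (t - s + u) = 1 - u / (t - s + u) := by linarith
  rw [hsum'] at h1 h2
  have p1 := hF.cdf_pos (t := s - u) (by linarith)
  have p2 := hF.cdf_pos (t := t) (by linarith)
  have p3 := hF.cdf_pos (t := t - u) (by linarith)
  have p4 := hF.cdf_pos (t := s) (by linarith)
  rw [← Real.log_le_log_iff (by positivity) (by positivity), Real.log_mul p1.ne' p2.ne',
    Real.log_mul p3.ne' p4.ne']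
  linarith

/-- That is, `shortfall / cdf` strictly increases. The integrands compare weakly on `[0, s]`;
strictness comes from the additional piece over `[s, t]`, where the cdf is positive. -/
theorem IsPrior.shortfall_mul_cdf_lt (hF : IsPrior F) {s t : ℝ} (hs : 0 < s) (hst : s < t)
    (ht : t ≤ 1) : shortfall F s * cdf F t < shortfall F t * cdf F s := by
  have hc := hF.continuous_cdf
  have hi : ∀ r a b : ℝ, IntervalIntegrable (fun u => cdf F (r - u)) volume a b := fun r a b =>
    (hc.comp (continuous_const.sub continuous_id)).intervalIntegrable a b
  rw [hF.shortfall_eq_integral_cdf hs.le, hF.shortfall_eq_integral_cdf (hs.trans hst).le,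
    ← intervalIntegral.integral_add_adjacent_intervals (hi t 0 s) (hi t s t), add_mul,
    ← intervalIntegral.integral_mul_const, ← intervalIntegral.integral_mul_const]
  have h1 : ∫ u in (0 : ℝ)..s, cdf F (s - u) * cdf F t ≤ ∫ u in (0 : ℝ)..s, cdf F (t - u) * cdf F s :=
    intervalIntegral.integral_mono_on hs.le ((hi s 0 s).mul_const _) ((hi t 0 s).mul_const _)
      fun u hu => hF.cdf_mul_cdf_le hst ht hu.1 hu.2
  have h2 : 0 < ∫ u in s..t, cdf F (t - u) :=
    intervalIntegral.intervalIntegral_pos_of_pos_on (hi t s t)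
      (fun u hu => hF.cdf_pos (by linarith [hu.2])) hst
  have := mul_pos h2 (hF.cdf_pos hs)
  linarith

/-- Clearing the denominator gives an equation between continuous functions of the cutoff. -/
theorem IsPrior.eq_condMean_iff (hF : IsPrior F) {γ α : ℝ} (h : 0 < α + γ) :
    α = condMean F (Iic (α + γ)) ↔ shortfall F (α + γ) = γ * cdf F (α + γ) := by
  have := hF.prob
  have hp := hF.cdf_pos h
  rw [condMean_eq, ← cdf_eq_real, hF.shortfall_eq_setIntegral, eq_inv_mul_iff_mul_eq₀ hp.ne']
  constructor <;> intro h' <;> linarith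

theorem IsPrior.setIntegral_id_pos (hF : IsPrior F) {A : Set ℝ} (hA : F A ≠ 0) :
    0 < ∫ θ in A, θ ∂F := by
  rw [setIntegral_pos_iff_support_of_nonneg_ae]
  · rw [pos_iff_ne_zero]
    intro h0
    refine hA ?_
    rw [← h0]
    refine (measure_congr ?_).symm
    filter_upwards [hF.ae_mem_Ioo] with θ hθ
    have : θ ∈ Function.support (fun x : ℝ => x) := by simpa using hθ.1.ne'
    exact propext ⟨fun h => h.2, fun h => ⟨this, h⟩⟩
  · exact ae_restrict_of_ae (hF.ae_mem_Ioo.mono fun θ h => h.1.le)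
  · exact (hF.integrable_of_continuous continuous_id).integrableOn

theorem IsPrior.condMean_pos (hF : IsPrior F) {A : Set ℝ} (hA : F A ≠ 0) :
    0 < condMean F A := by
  have := hF.prob
  rw [condMean_eq]
  have : 0 < F.real A := ENNReal.toReal_pos hA (measure_ne_top _ _)
  have := hF.setIntegral_id_pos hA
  positivity

theorem IsPrior.shortfall_of_one_le (hF : IsPrior F) {s : ℝ} (hs : 1 ≤ s) :
    shortfall F s = s - priorMean F := by
  rw [hF.shortfall_eq_setIntegral, hF.cdf_one_le hs, mul_one, priorMean]
  congr 1
  rw [← integral_indicator measurableSet_Iic]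
  refine integral_congr_ae (hF.ae_mem_Icc.mono fun θ h => ?_)
  exact indicator_of_mem (show θ ∈ Iic s from h.2.trans hs) _

/-- `E[θ | θ ≤ α + γ] = α` has exactly one solution. -/
theorem IsPrior.exists_threshold (hF : IsPrior F) {γ : ℝ} (hγ0 : 0 < γ)
    (hγ1 : γ < 1 - priorMean F) :
    ∃ α ∈ Ioo (0 : ℝ) 1, α + γ < 1 ∧ α = condMean F (Iic (α + γ)) ∧
      ∀ β ∈ Icc (0 : ℝ) 1, shortfall F (β + γ) = γ * cdf F (β + γ) → β = α := by
  have := hF.prob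
  -- The signs at the cutoffs `γ` (where `α = 0`) and `1` are opposite, which yields existence.
  have hlow : shortfall F γ ≤ γ * cdf F γ := by
    rw [hF.shortfall_eq_setIntegral]
    have : 0 ≤ ∫ θ in Iic γ, θ ∂F :=
      integral_nonneg_of_ae (ae_restrict_of_ae (hF.ae_mem_Ioo.mono fun θ h => h.1.le))
    linarith
  have hμ : 0 ≤ priorMean F := integral_nonneg_of_ae (hF.ae_mem_Ioo.mono fun θ h => h.1.le)
  -- From `1` on the equation would read `s - μ = γ`, but `s - μ ≥ 1 - μ > γ`.
  have hup : ∀ s, 1 ≤ s → γ * cdf F s < shortfall F s := by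
    intro s hs
    rw [hF.shortfall_of_one_le hs, hF.cdf_one_le hs]
    linarith
  have hcont : ContinuousOn (fun s => shortfall F s - γ * cdf F s) (Icc γ 1) :=
    (hF.continuous_shortfall.sub (hF.continuous_cdf.const_mul γ)).continuousOn
  obtain ⟨s, hs, hs0⟩ := intermediate_value_Icc (by linarith : γ ≤ 1) hcont
    (show (0 : ℝ) ∈ Icc _ _ from ⟨by linarith, by linarith [hup 1 le_rfl]⟩)
  simp only at hs0
  have hs1 : s < 1 := lt_of_not_ge fun h => by linarith [hup s h]
  have heq : s - γ = condMean F (Iic (s - γ + γ)) := by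
    rw [hF.eq_condMean_iff (by linarith [hs.1])]
    rw [sub_add_cancel]; linarith
  have hpos : 0 < s - γ := by
    rw [heq]
    refine hF.condMean_pos fun h0 => ?_
    have := hF.cdf_pos (t := s - γ + γ) (by linarith [hs.1])
    rw [cdf_eq_real, measureReal_def, h0] at this
    simp at this
  refine ⟨s - γ, ⟨hpos, by linarith⟩, by linarith, heq, fun β hβ hβeq => ?_⟩
  have hβ1 : β + γ < 1 := lt_of_not_ge fun h => by linarith [hup _ h]
  have hp1 := hF.cdf_pos (t := s) (by linarith)
  have hp2 := hF.cdf_pos (t := β + γ) (by linarith [hβ.1])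
  have hs0' : shortfall F s = γ * cdf F s := by linarith
  rcases lt_trichotomy (β + γ) s with h | h | h
  · have := hF.shortfall_mul_cdf_lt (by linarith [hβ.1]) h hs1.le
    rw [hβeq, hs0'] at this
    linarith [mul_right_comm γ (cdf F s) (cdf F (β + γ))]
  · linarith
  · have := hF.shortfall_mul_cdf_lt (by linarith) h hβ1.le
    rw [hβeq, hs0'] at this
    linarith [mul_right_comm γ (cdf F s) (cdf F (β + γ))]

end Prior

/-! ### The joint law of state, posterior mean and decision -/

section Outcome

variable {F : Measure ℝ} {σ : Signal F} {d : Kernel ℝ Bool}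

instance Signal.isMarkovKernel (σ : Signal F) : IsMarkovKernel σ.kernel := σ.markov

instance isProbabilityMeasure_outcome [IsProbabilityMeasure F] [IsMarkovKernel d] :
    IsProbabilityMeasure (outcome σ d) := by
  unfold outcome
  infer_instance

instance Signal.isProbabilityMeasure_dist [IsProbabilityMeasure F] :
    IsProbabilityMeasure σ.dist := by
  unfold Signal.dist
  infer_instance

theorem Signal.ae_fst_mem_Ioo (hF : IsPrior F) (σ : Signal F) :
    ∀ᵐ z ∂(F ⊗ₘ σ.kernel), z.1 ∈ Ioo (0 : ℝ) 1 := by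
  have := hF.prob
  exact Measure.ae_compProd_of_ae_fst _ measurableSet_Ioo hF.ae_mem_Ioo

theorem Signal.ae_snd_mem_Icc (hF : IsPrior F) (σ : Signal F) :
    ∀ᵐ z ∂(F ⊗ₘ σ.kernel), z.2 ∈ Icc (0 : ℝ) 1 := by
  have := hF.prob
  refine Measure.ae_compProd_of_ae_ae (measurable_snd measurableSet_Icc) ?_
  filter_upwards [hF.ae_mem_Icc] with θ hθ
  exact σ.mem_unit θ hθ

theorem Signal.integrable_of_continuous (hF : IsPrior F) (σ : Signal F) {g : ℝ × ℝ → ℝ}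
    (hg : Continuous g) : Integrable g (F ⊗ₘ σ.kernel) := by
  have := hF.prob
  obtain ⟨C, hC⟩ := ((isCompact_Icc (a := (0 : ℝ)) (b := 1)).prod
    (isCompact_Icc (a := (0 : ℝ)) (b := 1))).exists_bound_of_continuousOn hg.continuousOn
  refine Integrable.of_bound hg.aestronglyMeasurable C ?_
  filter_upwards [σ.ae_fst_mem_Ioo hF, σ.ae_snd_mem_Icc hF] with z h1 h2
  exact hC z ⟨Ioo_subset_Icc_self h1, h2⟩

/-- Posterior means take the values `0` and `1` with probability zero. -/
theorem Signal.ae_snd_mem_Ioo (hF : IsPrior F) (σ : Signal F) :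
    ∀ᵐ z ∂(F ⊗ₘ σ.kernel), z.2 ∈ Ioo (0 : ℝ) 1 := by
  have := hF.prob
  -- On `{x = a}` the state averages to `a`; for `a = 0` or `a = 1` this contradicts `0 < θ < 1`
  -- unless the event is null.
  have key : ∀ a : ℝ,
      ∫ z in {z : ℝ × ℝ | z.2 ∈ ({a} : Set ℝ)}, (z.1 - a) ∂(F ⊗ₘ σ.kernel) = 0 := by
    intro a
    have hm : MeasurableSet {z : ℝ × ℝ | z.2 ∈ ({a} : Set ℝ)} :=
      measurable_snd (measurableSet_singleton a)
    rw [integral_sub (σ.integrable_of_continuous hF continuous_fst).integrableOn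
      (integrable_const _), σ.posterior_mean _ (measurableSet_singleton a), sub_eq_zero]
    exact setIntegral_congr_fun hm fun z hz => hz
  have h0 : ∀ᵐ z ∂(F ⊗ₘ σ.kernel), z.2 ≠ 0 := by
    have hm : MeasurableSet {z : ℝ × ℝ | z.2 ∈ ({0} : Set ℝ)} :=
      measurable_snd (measurableSet_singleton 0)
    have h := key 0
    rw [setIntegral_eq_zero_iff_of_nonneg_ae
      (ae_restrict_of_ae ((σ.ae_fst_mem_Ioo hF).mono fun z hz => by simpa using hz.1.le))
      (σ.integrable_of_continuous hF (by fun_prop)).integrableOn] at h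
    filter_upwards [(ae_restrict_iff' hm).1 h, σ.ae_fst_mem_Ioo hF] with z hz hz1 hz2
    have := hz hz2
    simp only [Pi.zero_apply] at this
    linarith [hz1.1]
  have h1 : ∀ᵐ z ∂(F ⊗ₘ σ.kernel), z.2 ≠ 1 := by
    have hm : MeasurableSet {z : ℝ × ℝ | z.2 ∈ ({1} : Set ℝ)} :=
      measurable_snd (measurableSet_singleton 1)
    have h := key 1
    rw [← neg_eq_zero, ← integral_neg] at h
    rw [setIntegral_eq_zero_iff_of_nonneg_ae
      (ae_restrict_of_ae ((σ.ae_fst_mem_Ioo hF).mono fun z hz => by simpa using hz.2.le))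
      (σ.integrable_of_continuous hF (by fun_prop)).integrableOn] at h
    filter_upwards [(ae_restrict_iff' hm).1 h, σ.ae_fst_mem_Ioo hF] with z hz hz1 hz2
    have := hz hz2
    simp only [Pi.zero_apply] at this
    linarith [hz1.2]
  filter_upwards [σ.ae_snd_mem_Icc hF, h0, h1] with z hz hz0 hz1
  exact ⟨lt_of_le_of_ne hz.1 hz0.symm, lt_of_le_of_ne hz.2 hz1⟩

/-- The labelling condition says `E[θ - x | x] = 0`, and a bounded function of `x` pulls out of the
conditional expectation. -/
theorem Signal.integral_mul_sub_eq_zero (hF : IsPrior F) (σ : Signal F) {ψ : ℝ → ℝ}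
    (hψ : Measurable ψ) {C : ℝ} (hC : ∀ x ∈ Icc (0 : ℝ) 1, |ψ x| ≤ C) :
    ∫ z, ψ z.2 * (z.1 - z.2) ∂(F ⊗ₘ σ.kernel) = 0 := by
  have := hF.prob
  have hm : MeasurableSpace.comap (Prod.snd : ℝ × ℝ → ℝ) inferInstance ≤
      (inferInstance : MeasurableSpace (ℝ × ℝ)) :=
    measurable_snd.comap_le
  have hint : Integrable (fun z : ℝ × ℝ => z.1 - z.2) (F ⊗ₘ σ.kernel) :=
    σ.integrable_of_continuous hF (by fun_prop)
  have hzero : (0 : ℝ × ℝ → ℝ) =ᵐ[F ⊗ₘ σ.kernel] (F ⊗ₘ σ.kernel)[fun z : ℝ × ℝ => z.1 - z.2 |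
      MeasurableSpace.comap (Prod.snd : ℝ × ℝ → ℝ) inferInstance] := by
    refine ae_eq_condExp_of_forall_setIntegral_eq hm hint (fun _ _ _ => integrableOn_zero) ?_
      aestronglyMeasurable_zero
    rintro _ ⟨B, hB, rfl⟩ -
    rw [integral_sub (σ.integrable_of_continuous hF continuous_fst).integrableOn
      (σ.integrable_of_continuous hF continuous_snd).integrableOn]
    have := σ.posterior_mean B hB
    simp only [Pi.zero_apply, integral_zero]
    rw [eq_comm, sub_eq_zero]
    exact this
  have hψm : StronglyMeasurable[MeasurableSpace.comap (Prod.snd : ℝ × ℝ → ℝ) inferInstance]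
      (fun z : ℝ × ℝ => ψ z.2) :=
    (hψ.comp (comap_measurable _)).stronglyMeasurable
  have hmul : Integrable ((fun z : ℝ × ℝ => ψ z.2) * fun z => z.1 - z.2) (F ⊗ₘ σ.kernel) :=
    hint.bdd_mul (hψ.comp measurable_snd).aestronglyMeasurable
      ((σ.ae_snd_mem_Icc hF).mono fun z hz => hC _ hz)
  have h := condExp_mul_of_stronglyMeasurable_left hψm hmul hint
  have h2 := integral_condExp (μ := F ⊗ₘ σ.kernel) hm
    (f := (fun z : ℝ × ℝ => ψ z.2) * fun z => z.1 - z.2)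
  simp only [Pi.mul_apply] at h2
  rw [← h2, integral_congr_ae h]
  refine integral_eq_zero_of_ae ?_
  filter_upwards [hzero] with z hz
  simp [← hz]

theorem outcome_eq_map [IsProbabilityMeasure F] [IsMarkovKernel d] : outcome σ d =
    ((F ⊗ₘ σ.kernel) ⊗ₘ Kernel.prodMkLeft ℝ d).map MeasurableEquiv.prodAssoc :=
  Measure.compProd_assoc'.symm

theorem map_outcome_signal [IsProbabilityMeasure F] [IsMarkovKernel d] :
    (outcome σ d).map (fun z => (z.1, z.2.1)) = F ⊗ₘ σ.kernel := by
  rw [outcome_eq_map, Measure.map_map (by fun_prop) (by fun_prop)]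
  exact Measure.fst_compProd _ _

theorem map_outcome_fst [IsProbabilityMeasure F] [IsMarkovKernel d] :
    (outcome σ d).map Prod.fst = F :=
  Measure.fst_compProd _ _

theorem map_outcome_posterior [IsProbabilityMeasure F] [IsMarkovKernel d] :
    (outcome σ d).map (fun z => z.2.1) = σ.dist := by
  rw [Signal.dist, Measure.snd, ← map_outcome_signal (d := d),
    Measure.map_map (by fun_prop) (by fun_prop)]
  rfl

theorem ae_outcome_of_ae_signal [IsProbabilityMeasure F] [IsMarkovKernel d] {p : ℝ × ℝ → Prop}
    (h : ∀ᵐ z ∂(F ⊗ₘ σ.kernel), p z) : ∀ᵐ z ∂(outcome σ d), p (z.1, z.2.1) := by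
  rw [← map_outcome_signal (d := d)] at h
  exact ae_of_ae_map (by fun_prop) h

theorem ae_outcome_of_ae_prior [IsProbabilityMeasure F] [IsMarkovKernel d] {p : ℝ → Prop}
    (h : ∀ᵐ θ ∂F, p θ) : ∀ᵐ z ∂(outcome σ d), p z.1 := by
  rw [← map_outcome_fst (σ := σ) (d := d)] at h
  exact ae_of_ae_map (by fun_prop) h

theorem ae_outcome_state (hF : IsPrior F) [IsMarkovKernel d] :
    ∀ᵐ z ∂(outcome σ d), z.1 ∈ Ioo (0 : ℝ) 1 := by
  have := hF.prob
  exact ae_outcome_of_ae_prior hF.ae_mem_Ioo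

theorem ae_outcome_posterior (hF : IsPrior F) [IsMarkovKernel d] :
    ∀ᵐ z ∂(outcome σ d), z.2.1 ∈ Ioo (0 : ℝ) 1 := by
  have := hF.prob
  exact ae_outcome_of_ae_signal (σ.ae_snd_mem_Ioo hF)

theorem integral_outcome_state [IsProbabilityMeasure F] [IsMarkovKernel d] {g : ℝ → ℝ}
    (hg : Measurable g) : ∫ z, g z.1 ∂(outcome σ d) = ∫ θ, g θ ∂F := by
  conv_rhs => rw [← map_outcome_fst (σ := σ) (d := d)]
  exact (integral_map (by fun_prop) hg.aestronglyMeasurable).symm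

theorem integrable_outcome_of_bound (hF : IsPrior F) [IsMarkovKernel d]
    {g : ℝ × ℝ × Bool → ℝ} (hg : Measurable g) (C : ℝ)
    (h : ∀ z, z.1 ∈ Icc (0 : ℝ) 1 → z.2.1 ∈ Icc (0 : ℝ) 1 → |g z| ≤ C) :
    Integrable g (outcome σ d) := by
  have := hF.prob
  refine Integrable.of_bound hg.aestronglyMeasurable C ?_
  filter_upwards [ae_outcome_state (σ := σ) (d := d) hF,
    ae_outcome_posterior (σ := σ) (d := d) hF] with z h1 h2
  exact h z (Ioo_subset_Icc_self h1) (Ioo_subset_Icc_self h2)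

theorem continuous_of_forall_bool {g : ℝ × ℝ × Bool → ℝ}
    (hg : ∀ b, Continuous fun p : ℝ × ℝ => g (p.1, p.2, b)) : Continuous g := by
  have h : Continuous fun p : (ℝ × ℝ) × Bool => g (p.1.1, p.1.2, p.2) :=
    continuous_prod_of_discrete_right.2 hg
  exact h.comp (by fun_prop : Continuous fun z : ℝ × ℝ × Bool => ((z.1, z.2.1), z.2.2))

theorem integrable_outcome (hF : IsPrior F) [IsMarkovKernel d] {g : ℝ × ℝ × Bool → ℝ}
    (hg : ∀ b, Continuous fun p : ℝ × ℝ => g (p.1, p.2, b)) : Integrable g (outcome σ d) := by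
  have hc := continuous_of_forall_bool hg
  obtain ⟨C, hC⟩ := ((isCompact_Icc (a := (0 : ℝ)) (b := 1)).prod
    ((isCompact_Icc (a := (0 : ℝ)) (b := 1)).prod (isCompact_univ (X := Bool)))).exists_bound_of_continuousOn
      hc.continuousOn
  exact integrable_outcome_of_bound hF hc.measurable C fun z h1 h2 => hC z ⟨h1, h2, trivial⟩

/-- The state is independent of the message given the posterior mean. -/
theorem integral_outcome_mul_sub_eq_zero (hF : IsPrior F) [IsMarkovKernel d]
    {ψ : ℝ → Bool → ℝ} (hψ : ∀ b, Continuous fun x => ψ x b) :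
    ∫ z, ψ z.2.1 z.2.2 * (z.1 - z.2.1) ∂(outcome σ d) = 0 := by
  have := hF.prob
  have hint : Integrable (fun z : ℝ × ℝ × Bool => ψ z.2.1 z.2.2 * (z.1 - z.2.1)) (outcome σ d) :=
    integrable_outcome hF fun b => ((hψ b).comp continuous_snd).mul (by fun_prop)
  have hmeas : Measurable fun z : ℝ × ℝ × Bool => ψ z.2.1 z.2.2 * (z.1 - z.2.1) :=
    (continuous_of_forall_bool fun b => ((hψ b).comp continuous_snd).mul (by fun_prop)).measurable
  rw [outcome_eq_map] at hint ⊢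
  rw [integral_map (by fun_prop) hmeas.aestronglyMeasurable]
  rw [integrable_map_measure hmeas.aestronglyMeasurable (by fun_prop)] at hint
  refine (Measure.integral_compProd hint).trans ?_
  have hd : ∀ b, Measurable fun x => (d x).real {b} := fun b =>
    (d.measurable_coe (measurableSet_singleton b)).ennreal_toReal
  choose C hC using fun b => (isCompact_Icc (a := (0 : ℝ)) (b := 1)).exists_bound_of_continuousOn
    (hψ b).continuousOn
  have h := σ.integral_mul_sub_eq_zero hF
    -- Averaging `ψ x b` over the decision drawn at `x` leaves a bounded function of `x` alone.
    (ψ := fun x => (d x).real {true} * ψ x true + (d x).real {false} * ψ x false)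
    (C := C true + C false)
    (((hd true).mul (hψ true).measurable).add ((hd false).mul (hψ false).measurable)) ?_
  · rw [← h]
    refine integral_congr_ae (ae_of_all _ fun z => ?_)
    dsimp only
    rw [integral_fintype .of_finite]
    simp [MeasurableEquiv.prodAssoc]
    ring
  · intro x hx
    have hb : ∀ b, |(d x).real {b} * ψ x b| ≤ C b := fun b => by
      rw [abs_mul, abs_of_nonneg measureReal_nonneg]
      exact (mul_le_of_le_one_left (abs_nonneg _) measureReal_le_one).trans (hC b x hx)
    exact (abs_add_le _ _).trans (add_le_add (hb true) (hb false))

end Outcome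

/-! ### Payoffs as forgone gains, and the deviation to full information -/

section Payoff

variable {F : Measure ℝ} {σ : Signal F} {d : Kernel ℝ Bool}

/-- What the sender forgoes, given the state, by a certification decision made without knowing
it, if the action after `m_∅` is `α`. -/
noncomputable def loss (α γ : ℝ) (z : ℝ × ℝ × Bool) : ℝ :=
  max α (z.1 - γ) - if z.2.2 = true then z.1 - γ else α

theorem loss_nonneg (α γ : ℝ) (z : ℝ × ℝ × Bool) : 0 ≤ loss α γ z := by
  unfold loss
  split_ifs
  · exact sub_nonneg.2 (le_max_right _ _)
  · exact sub_nonneg.2 (le_max_left _ _)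

theorem continuous_loss (α γ : ℝ) (b : Bool) :
    Continuous fun p : ℝ × ℝ => loss α γ (p.1, p.2, b) := by
  cases b <;> simp only [loss, Bool.false_eq_true, if_true, if_false] <;> fun_prop

theorem integral_ite_posterior (hF : IsPrior F) [IsMarkovKernel d] (α γ : ℝ) :
    ∫ z, (if z.2.2 = true then z.2.1 - γ else α) ∂(outcome σ d) =
      ∫ z, (if z.2.2 = true then z.1 - γ else α) ∂(outcome σ d) := by
  have h := integral_outcome_mul_sub_eq_zero hF (σ := σ) (d := d)
    (ψ := fun _ b => if b = true then 1 else 0) (fun b => continuous_const)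
  rw [← sub_eq_zero, ← integral_sub, ← neg_eq_zero, ← integral_neg, ← h]
  · refine integral_congr_ae (ae_of_all _ fun z => ?_)
    dsimp only
    split_ifs <;> ring
  · refine integrable_outcome hF fun b => ?_
    cases b <;> simp only [Bool.false_eq_true, if_true, if_false] <;> fun_prop
  · refine integrable_outcome hF fun b => ?_
    cases b <;> simp only [Bool.false_eq_true, if_true, if_false] <;> fun_prop

theorem senderPayoff_eq (hF : IsPrior F) [IsMarkovKernel d] {c : ℝ → ℝ} {γ κ : ℝ}
    {a : Option ℝ → ℝ} (ha : ∀ x ∈ Icc (0 : ℝ) 1, a (some x) = x) :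
    senderPayoff c γ κ σ d a =
      (∫ z, (if z.2.2 = true then z.2.1 - γ else a none) ∂(outcome σ d)) -
        κ * ∫ x, c x ∂σ.dist := by
  rw [senderPayoff]
  congr 1
  refine integral_congr_ae ?_
  filter_upwards [ae_outcome_posterior (σ := σ) (d := d) hF] with z hz
  by_cases hb : z.2.2 = true
  · simp [message, hb, ha _ (Ioo_subset_Icc_self hz)]
  · simp [message, hb]

/-- The first term does not depend on the sender's strategy, so for a given action after `m_∅` only
the loss and the information cost matter to her. -/
theorem senderPayoff_eq_sub_loss (hF : IsPrior F) [IsMarkovKernel d] {c : ℝ → ℝ} {γ κ : ℝ}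
    {a : Option ℝ → ℝ} (ha : ∀ x ∈ Icc (0 : ℝ) 1, a (some x) = x) :
    senderPayoff c γ κ σ d a =
      (∫ θ, max (a none) (θ - γ) ∂F) - (∫ z, loss (a none) γ z ∂(outcome σ d)) -
        κ * ∫ x, c x ∂σ.dist := by
  have := hF.prob
  rw [senderPayoff_eq hF ha, integral_ite_posterior hF]
  congr 1
  rw [← integral_outcome_state (σ := σ) (d := d) (g := fun θ => max (a none) (θ - γ))
    (by fun_prop), ← integral_sub]
  · refine integral_congr_ae (ae_of_all _ fun z => ?_)
    simp [loss]
  · exact integrable_outcome hF fun b => by fun_prop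
  · exact integrable_outcome hF (continuous_loss _ _)

theorem measurable_decide_le (s : ℝ) : Measurable fun x : ℝ => decide (s ≤ x) :=
  measurable_to_bool (by
    have : (fun x : ℝ => decide (s ≤ x)) ⁻¹' {true} = Ici s := by ext; simp
    rw [this]
    exact measurableSet_Ici)

/-- Certification of the posterior means that are at least `s`. -/
noncomputable def thresholdRule (s : ℝ) : Kernel ℝ Bool :=
  Kernel.deterministic (fun x => decide (s ≤ x)) (measurable_decide_le s)

instance isMarkovKernel_thresholdRule (s : ℝ) : IsMarkovKernel (thresholdRule s) := by
  unfold thresholdRule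
  infer_instance

theorem outcome_thresholdRule [IsProbabilityMeasure F] (s : ℝ) :
    outcome σ (thresholdRule s) =
      (F ⊗ₘ σ.kernel).map (fun z => (z.1, z.2, decide (s ≤ z.2))) := by
  have hm : Measurable fun z : ℝ × ℝ => decide (s ≤ z.2) :=
    (measurable_decide_le s).comp measurable_snd
  have h : Kernel.prodMkLeft ℝ (thresholdRule s) =
      Kernel.deterministic (fun z : ℝ × ℝ => decide (s ≤ z.2)) hm := by
    ext z : 1
    simp [thresholdRule, Kernel.prodMkLeft_apply, Kernel.deterministic_apply]
  have hm' : Measurable fun z : ℝ × ℝ => (z, decide (s ≤ z.2)) := measurable_id.prodMk hm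
  rw [outcome_eq_map, h, Measure.compProd_deterministic, Measure.map_map
    (MeasurableEquiv.measurable _) hm']
  rfl

/-- The cutoff `a none + γ` is the interim best reply: it attains the larger of the two payoffs at
every posterior mean. -/
theorem senderPayoff_thresholdRule (hF : IsPrior F) {c : ℝ → ℝ} {γ κ : ℝ}
    {a : Option ℝ → ℝ} (ha : ∀ x ∈ Icc (0 : ℝ) 1, a (some x) = x) :
    senderPayoff c γ κ σ (thresholdRule (a none + γ)) a =
      (∫ x, max (a none) (x - γ) ∂σ.dist) - κ * ∫ x, c x ∂σ.dist := by
  have := hF.prob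
  rw [senderPayoff_eq hF ha]
  congr 1
  have hm : Measurable fun z : ℝ × ℝ => (z.1, z.2, decide (a none + γ ≤ z.2)) :=
    measurable_fst.prodMk (measurable_snd.prodMk ((measurable_decide_le _).comp measurable_snd))
  rw [outcome_thresholdRule, integral_map hm.aemeasurable, Signal.dist, Measure.snd,
    integral_map (by fun_prop) (by fun_prop)]
  · refine integral_congr_ae (ae_of_all _ fun z => ?_)
    dsimp only
    by_cases h : a none + γ ≤ z.2
    · rw [if_pos (by simpa using h), max_eq_right (by linarith)]
    · rw [if_neg (by simpa using h), max_eq_left (by linarith)]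
  · refine (continuous_of_forall_bool fun b => ?_).aestronglyMeasurable
    cases b <;> simp only [Bool.false_eq_true, if_true, if_false] <;> fun_prop

/-- The signal whose realization is the function `f` of the state. -/
noncomputable def Signal.ofFun [IsProbabilityMeasure F] (f : ℝ → ℝ) (hf : Measurable f)
    (hmem : ∀ θ ∈ Icc (0 : ℝ) 1, f θ ∈ Icc (0 : ℝ) 1)
    (hmean : ∀ B : Set ℝ, MeasurableSet B →
      ∫ θ in f ⁻¹' B, θ ∂F = ∫ θ in f ⁻¹' B, f θ ∂F) : Signal F where
  kernel := Kernel.deterministic f hf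
  markov := inferInstance
  mem_unit θ hθ := by
    rw [Kernel.deterministic_apply, Measure.dirac_apply' _ measurableSet_Icc.compl]
    simpa using hmem θ hθ
  posterior_mean B hB := by
    have hB' : MeasurableSet {z : ℝ × ℝ | z.2 ∈ B} := measurable_snd hB
    rw [Measure.compProd_deterministic,
      setIntegral_map (f := fun z : ℝ × ℝ => z.1) hB' (by fun_prop) (by fun_prop),
      setIntegral_map (f := fun z : ℝ × ℝ => z.2) hB' (by fun_prop) (by fun_prop)]
    exact hmean B hB

theorem Signal.dist_ofFun [IsProbabilityMeasure F] {f : ℝ → ℝ} {hf : Measurable f}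
    {hmem : ∀ θ ∈ Icc (0 : ℝ) 1, f θ ∈ Icc (0 : ℝ) 1}
    {hmean : ∀ B : Set ℝ, MeasurableSet B →
      ∫ θ in f ⁻¹' B, θ ∂F = ∫ θ in f ⁻¹' B, f θ ∂F} :
    (Signal.ofFun f hf hmem hmean).dist = F.map f := by
  rw [Signal.dist, Signal.ofFun, Measure.compProd_deterministic, Measure.snd,
    Measure.map_map (by fun_prop) (by fun_prop)]
  rfl

/-- Full information. -/
noncomputable def Signal.full (F : Measure ℝ) [IsProbabilityMeasure F] : Signal F :=
  Signal.ofFun (fun θ => θ) measurable_id (fun _ h => h) fun _ _ => rfl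

theorem Signal.dist_full [IsProbabilityMeasure F] : (Signal.full F).dist = F := by
  rw [Signal.full, Signal.dist_ofFun]
  exact Measure.map_id

theorem Signal.ae_dist_mem_Ioo (hF : IsPrior F) (σ : Signal F) :
    ∀ᵐ x ∂σ.dist, x ∈ Ioo (0 : ℝ) 1 := by
  rw [Signal.dist, Measure.snd, ae_map_iff (p := fun x => x ∈ Ioo (0 : ℝ) 1) (by fun_prop) measurableSet_Ioo]
  exact σ.ae_snd_mem_Ioo hF

theorem IsCost.integrable {m : ℝ} {c : ℝ → ℝ} (hc : IsCost m c) {G : Measure ℝ}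
    [IsFiniteMeasure G] (hG : ∀ᵐ x ∂G, x ∈ Ioo (0 : ℝ) 1) : Integrable c G := by
  obtain ⟨B, hB⟩ := hc.bounded
  refine Integrable.of_bound ?_ B (hG.mono hB)
  have h := hc.diff.continuousOn.aestronglyMeasurable (μ := G) measurableSet_Ioo
  rwa [Measure.restrict_eq_self_of_ae_mem hG] at h

/-- A strictly convex function lies strictly above its tangents. -/
theorem IsCost.lt_of_ne {m : ℝ} {c : ℝ → ℝ} (hc : IsCost m c) {x y : ℝ}
    (hx : x ∈ Ioo (0 : ℝ) 1) (hy : y ∈ Ioo (0 : ℝ) 1) (hxy : x ≠ y) :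
    c y + deriv c y * (x - y) < c x := by
  have hd : DifferentiableAt ℝ c y := (hc.diff y hy).differentiableAt (Ioo_mem_nhds hy.1 hy.2)
  rcases hxy.lt_or_gt with h | h
  · have h1 := hc.strictConvex.slope_lt_deriv hx hy h hd
    rw [slope_def_field, div_lt_iff₀ (by linarith)] at h1
    linarith
  · have h1 := hc.strictConvex.deriv_lt_slope hy hx h hd
    rw [slope_def_field, lt_div_iff₀ (by linarith)] at h1
    linarith

theorem IsCovertEquilibrium.action_some {c : ℝ → ℝ} {γ κ : ℝ} {e : Assessment F}
    (he : IsCovertEquilibrium c γ κ e) : ∀ x ∈ Icc (0 : ℝ) 1, e.action (some x) = x := by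
  intro x hx
  rw [he.action_eq _ (Or.inr ⟨x, hx, rfl⟩), he.belief_cert x hx]

theorem IsCovertEquilibrium.action_none {c : ℝ → ℝ} {γ κ : ℝ} {e : Assessment F}
    (he : IsCovertEquilibrium c γ κ e) : e.action none = e.belief none :=
  he.action_eq _ (Or.inl rfl)

/-- The deviation to full information. -/
theorem IsCovertEquilibrium.integral_loss_le (hF : IsPrior F) {c : ℝ → ℝ} {γ κ : ℝ}
    {e : Assessment F} (he : IsCovertEquilibrium c γ κ e) :
    ∫ z, loss (e.action none) γ z ∂e.law ≤ κ * (∫ x, c x ∂F - ∫ x, c x ∂e.signal.dist) := by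
  have := hF.prob
  have := e.markov
  have h := he.optimal (Signal.full F) (thresholdRule (e.action none + γ)) inferInstance
  rw [senderPayoff_thresholdRule hF he.action_some,
    senderPayoff_eq_sub_loss hF he.action_some, Signal.dist_full] at h
  unfold Assessment.law
  linarith

theorem IsCovertEquilibrium.integral_loss_le_mul (hF : IsPrior F) {c : ℝ → ℝ} {B : ℝ}
    (hB : ∀ x ∈ Ioo (0 : ℝ) 1, |c x| ≤ B) {γ κ : ℝ} (hκ : 0 ≤ κ)
    {e : Assessment F} (he : IsCovertEquilibrium c γ κ e) :
    ∫ z, loss (e.action none) γ z ∂e.law ≤ κ * (2 * B) := by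
  have := hF.prob
  refine (he.integral_loss_le hF).trans (mul_le_mul_of_nonneg_left ?_ hκ)
  have h1 := norm_integral_le_of_norm_le_const (hF.ae_mem_Ioo.mono fun x hx => show ‖c x‖ ≤ B from hB x hx)
  have h2 := norm_integral_le_of_norm_le_const
    ((e.signal.ae_dist_mem_Ioo hF).mono fun x hx => show ‖c x‖ ≤ B from hB x hx)
  simp only [probReal_univ, mul_one, Real.norm_eq_abs] at h1 h2
  linarith [(abs_le.1 h1).2, (abs_le.1 h2).1]

end Payoff

/-! ### Costly information: one posterior mean per decision -/

section Pooling

variable {F : Measure ℝ} {σ : Signal F} {d : Kernel ℝ Bool}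

/-- The event that the certification decision is `b`. -/
def decision (b : Bool) : Set (ℝ × ℝ × Bool) := {z | z.2.2 = b}

theorem measurableSet_decision (b : Bool) : MeasurableSet (decision b) :=
  (measurable_snd.comp measurable_snd) (measurableSet_singleton b)

theorem compl_decision_true : (decision true)ᶜ = decision false := by
  ext z; simp [decision]

/-- `E[θ | b]`, or `1/2` off the path. -/
noncomputable def decisionMean (P : Measure (ℝ × ℝ × Bool)) (b : Bool) : ℝ :=
  if P.real (decision b) = 0 then 1 / 2 else (∫ z in decision b, z.1 ∂P) / P.real (decision b)

theorem integral_eq_add_decision {P : Measure (ℝ × ℝ × Bool)} {g : ℝ × ℝ × Bool → ℝ}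
    (hg : Integrable g P) :
    ∫ z, g z ∂P = (∫ z in decision true, g z ∂P) + ∫ z in decision false, g z ∂P := by
  rw [← compl_decision_true, integral_add_compl (measurableSet_decision true) hg]

theorem integrable_outcome_state (hF : IsPrior F) [IsMarkovKernel d] :
    Integrable (fun z => z.1) (outcome σ d) := by
  exact integrable_outcome hF fun b => by fun_prop

theorem decisionMean_mul (hF : IsPrior F) [IsMarkovKernel d] (b : Bool) :
    ∫ z in decision b, (z.1 - decisionMean (outcome σ d) b) ∂(outcome σ d) = 0 := by
  have := hF.prob
  rw [integral_sub (integrable_outcome_state hF).integrableOn (integrable_const _)]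
  simp only [integral_const, smul_eq_mul, measureReal_restrict_apply_univ]
  by_cases h : (outcome σ d).real (decision b) = 0
  · rw [h, zero_mul, sub_zero]
    rw [measureReal_eq_zero_iff] at h
    rw [Measure.restrict_eq_zero.2 h, integral_zero_measure]
  · rw [decisionMean, if_neg h]
    field_simp
    simp

theorem integral_mul_sub_decisionMean (hF : IsPrior F) [IsMarkovKernel d] (φ : Bool → ℝ) :
    ∫ z, φ z.2.2 * (z.1 - decisionMean (outcome σ d) z.2.2) ∂(outcome σ d) = 0 := by
  have key : ∀ b, ∫ z in decision b, φ z.2.2 * (z.1 - decisionMean (outcome σ d) z.2.2)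
      ∂(outcome σ d) = 0 := by
    intro b
    have : ∫ z in decision b, φ z.2.2 * (z.1 - decisionMean (outcome σ d) z.2.2) ∂(outcome σ d) =
        ∫ z in decision b, φ b * (z.1 - decisionMean (outcome σ d) b) ∂(outcome σ d) :=
      setIntegral_congr_fun (measurableSet_decision b) fun z hz => by
        have hz' : z.2.2 = b := hz
        simp only [hz']
    rw [this, integral_const_mul, decisionMean_mul hF, mul_zero]
  rw [integral_eq_add_decision (integrable_outcome hF fun b => by fun_prop), key, key, add_zero]

/-- The interior is needed because `c` is controlled, and has tangents, only on `(0, 1)`; the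
off-path default `1/2` respects this. -/
theorem decisionMean_mem_Ioo (hF : IsPrior F) [IsMarkovKernel d] (b : Bool) :
    decisionMean (outcome σ d) b ∈ Ioo (0 : ℝ) 1 := by
  have := hF.prob
  by_cases h : (outcome σ d).real (decision b) = 0
  · rw [decisionMean, if_pos h]
    constructor <;> norm_num
  have h0 : outcome σ d (decision b) ≠ 0 := fun h' => h (by rw [measureReal_def, h']; rfl)
  have hpos : 0 < (outcome σ d).real (decision b) := lt_of_le_of_ne measureReal_nonneg (Ne.symm h)
  have key : ∀ g : ℝ × ℝ × Bool → ℝ, Integrable g (outcome σ d) →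
      (∀ᵐ z ∂(outcome σ d), 0 < g z) → 0 < ∫ z in decision b, g z ∂(outcome σ d) := by
    intro g hg hgp
    rw [setIntegral_pos_iff_support_of_nonneg_ae (ae_restrict_of_ae (hgp.mono fun z hz => hz.le))
      hg.integrableOn, pos_iff_ne_zero]
    intro h'
    refine h0 ?_
    rw [← h']
    refine measure_congr ?_
    filter_upwards [hgp] with z hz
    exact propext ⟨fun h => ⟨hz.ne', h⟩, fun h => h.2⟩
  have h1 := key _ (integrable_outcome_state hF)
    ((ae_outcome_state hF).mono fun z hz => hz.1)
  have h2 := key (fun z => 1 - z.1) ((integrable_const _).sub (integrable_outcome_state hF))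
    ((ae_outcome_state hF).mono fun z hz => by linarith [hz.2])
  rw [integral_sub (integrable_const _) (integrable_outcome_state hF).integrableOn] at h2
  simp only [integral_const, smul_eq_mul, measureReal_restrict_apply_univ, mul_one] at h2
  rw [decisionMean, if_neg h]
  exact ⟨div_pos h1 hpos, (div_lt_one hpos).2 (by linarith)⟩

theorem compProd_map_decisionMean [IsProbabilityMeasure F] [IsMarkovKernel d] (y : Bool → ℝ) :
    F ⊗ₘ (σ.kernel ⊗ₖ Kernel.prodMkLeft ℝ d).map (fun p => y p.2) =
      (outcome σ d).map (fun z => (z.1, y z.2.2)) := by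
  have hy : Measurable fun p : ℝ × Bool => y p.2 := by fun_prop
  rw [outcome, Measure.compProd_map hy]
  rfl

/-- The coarsening of a signal that only reveals the certification decision. -/
noncomputable def Signal.pool (hF : IsPrior F) (σ : Signal F) (d : Kernel ℝ Bool)
    [hd : IsMarkovKernel d] : Signal F where
  kernel := (σ.kernel ⊗ₖ Kernel.prodMkLeft ℝ d).map (fun p => decisionMean (outcome σ d) p.2)
  markov := Kernel.IsMarkovKernel.map _ (by fun_prop)
  mem_unit θ _ := by
    rw [Kernel.map_apply' _ (by fun_prop) _ measurableSet_Icc.compl]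
    have : (fun p : ℝ × Bool => decisionMean (outcome σ d) p.2) ⁻¹' (Icc 0 1)ᶜ = ∅ := by
      ext p
      have h := decisionMean_mem_Ioo (σ := σ) (d := d) hF p.2
      simpa using ⟨h.1.le, h.2.le⟩
    rw [this, measure_empty]
  posterior_mean B hB := by
    have := hF.prob
    have hB' : MeasurableSet {z : ℝ × ℝ | z.2 ∈ B} := measurable_snd hB
    rw [compProd_map_decisionMean,
      setIntegral_map (f := fun z : ℝ × ℝ => z.1) hB' (by fun_prop) (by fun_prop),
      setIntegral_map (f := fun z : ℝ × ℝ => z.2) hB' (by fun_prop) (by fun_prop)]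
    have hm : MeasurableSet ((fun z : ℝ × ℝ × Bool => (z.1, decisionMean (outcome σ d) z.2.2)) ⁻¹'
        {z : ℝ × ℝ | z.2 ∈ B}) :=
      (by fun_prop : Measurable fun z : ℝ × ℝ × Bool =>
        (z.1, decisionMean (outcome σ d) z.2.2)) hB'
    rw [← sub_eq_zero, ← integral_sub (integrable_outcome_state hF).integrableOn
      (integrable_outcome hF fun b => by fun_prop).integrableOn, ← integral_indicator hm]
    -- Membership of the pooled mean in `B` is a function of the decision, hence orthogonal to the
    -- residual.
    rw [← integral_mul_sub_decisionMean hF (σ := σ) (d := d)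
      (fun b => by classical exact if decisionMean (outcome σ d) b ∈ B then 1 else 0)]
    refine integral_congr_ae (ae_of_all _ fun z => ?_)
    by_cases h : decisionMean (outcome σ d) z.2.2 ∈ B <;> dsimp only
    · rw [indicator_of_mem (by exact h), if_pos h, one_mul]
    · rw [indicator_of_notMem (by exact h), if_neg h, zero_mul]

theorem Signal.dist_pool (hF : IsPrior F) [IsMarkovKernel d] :
    (σ.pool hF d).dist = (outcome σ d).map (fun z => decisionMean (outcome σ d) z.2.2) := by
  have := hF.prob
  rw [Signal.dist, Signal.pool, compProd_map_decisionMean, Measure.snd,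
    Measure.map_map (by fun_prop) (by fun_prop)]
  rfl

/-- If information is costly, the sender acquires no more than her certification decision uses. -/
theorem IsCovertEquilibrium.posterior_eq (hF : IsPrior F) {c : ℝ → ℝ} {m : ℝ} (hc : IsCost m c)
    {γ κ : ℝ} (hκ : 0 < κ) {e : Assessment F} (he : IsCovertEquilibrium c γ κ e) :
    ∀ᵐ z ∂e.law, z.2.1 = decisionMean e.law z.2.2 := by
  have := hF.prob
  have := e.markov
  set P := outcome e.signal e.certify with hP
  have hlaw : e.law = P := rfl
  rw [hlaw]
  set y := decisionMean P with hy
  have hymem : ∀ b, y b ∈ Ioo (0 : ℝ) 1 := decisionMean_mem_Ioo hF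
  -- The deviation: learn only the original decision, then certify optimally.
  have hopt := he.optimal (e.signal.pool hF e.certify)
    (thresholdRule (e.action none + γ)) inferInstance
  rw [senderPayoff_thresholdRule hF he.action_some, senderPayoff_eq hF he.action_some,
    integral_ite_posterior hF] at hopt
  have hcint : Integrable c e.signal.dist := hc.integrable (e.signal.ae_dist_mem_Ioo hF)
  rw [Signal.dist_pool, ← map_outcome_posterior (d := e.certify), ← hP, ← hy] at hopt
  rw [← map_outcome_posterior (d := e.certify), ← hP] at hcint
  have hym : Measurable fun z : ℝ × ℝ × Bool => y z.2.2 := by fun_prop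
  have hcint' : Integrable c (P.map fun z => y z.2.2) := by
    have : IsProbabilityMeasure (P.map fun z => y z.2.2) :=
      Measure.isProbabilityMeasure_map hym.aemeasurable
    refine hc.integrable ?_
    rw [ae_map_iff (p := fun x => x ∈ Ioo (0 : ℝ) 1) hym.aemeasurable measurableSet_Ioo]
    exact ae_of_all _ fun z => hymem _
  rw [integral_map hym.aemeasurable (by fun_prop), integral_map hym.aemeasurable hcint'.1,
    integral_map (by fun_prop) hcint.1] at hopt
  rw [integrable_map_measure hcint.1 (by fun_prop)] at hcint
  rw [integrable_map_measure hcint'.1 hym.aemeasurable] at hcint'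
  -- Pooling loses no gross payoff. Repeating the old decision keeps it unchanged, as the residual
  -- `h0` has mean zero, and reoptimizing can only help.
  have h1 : ∫ z, (if z.2.2 = true then z.1 - γ else e.action none) ∂P ≤
      ∫ z, max (e.action none) (y z.2.2 - γ) ∂P := by
    have h0 := integral_mul_sub_decisionMean hF (σ := e.signal) (d := e.certify)
      (fun b => if b = true then 1 else 0)
    have hi : Integrable (fun z : ℝ × ℝ × Bool => if z.2.2 = true then z.1 - γ else e.action none)
        P := integrable_outcome hF fun b => by
      cases b <;> simp only [Bool.false_eq_true, if_true, if_false] <;> fun_prop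
    have hi2 : Integrable (fun z : ℝ × ℝ × Bool =>
        (if z.2.2 = true then (1 : ℝ) else 0) * (z.1 - y z.2.2)) P :=
      integrable_outcome hF fun b => by
        cases b <;> simp only [Bool.false_eq_true, if_true, if_false] <;> fun_prop
    rw [← sub_zero (∫ z, (if z.2.2 = true then z.1 - γ else e.action none) ∂P), ← h0, ← hP, ← hy,
      ← integral_sub hi hi2]
    refine integral_mono (hi.sub hi2) (integrable_outcome hF fun b => by fun_prop) fun z => ?_
    dsimp only
    split_ifs
    · refine le_trans (le_of_eq ?_) (le_max_right _ _); ring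
    · refine le_trans (le_of_eq ?_) (le_max_left _ _); ring
  have h2 : ∫ z, c z.2.1 ∂P ≤ ∫ z, c (y z.2.2) ∂P := by
    refine le_of_mul_le_mul_left ?_ hκ
    linarith
  obtain ⟨k, hk⟩ : ∃ k : Bool → ℝ, ∀ b, k b = deriv c (y b) := ⟨_, fun _ => rfl⟩
  -- The tangent terms average out: both `θ - y` and `θ - x` are orthogonal to functions of the
  -- decision.
  have h3 : ∫ z, k z.2.2 * (z.2.1 - y z.2.2) ∂P = 0 := by
    have ha := integral_mul_sub_decisionMean hF (σ := e.signal) (d := e.certify) k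
    have hb := integral_outcome_mul_sub_eq_zero hF (σ := e.signal) (d := e.certify)
      (ψ := fun _ b => k b) (fun b => continuous_const)
    rw [← hP] at ha hb
    rw [← hy] at ha
    have hab := integral_sub (μ := P) (f := fun z => k z.2.2 * (z.1 - y z.2.2))
      (g := fun z => k z.2.2 * (z.1 - z.2.1)) (integrable_outcome hF fun b => by fun_prop)
      (integrable_outcome hF fun b => by fun_prop)
    rw [ha, hb, sub_zero] at hab
    rw [← hab]
    refine integral_congr_ae (ae_of_all _ fun z => ?_)
    ring
  have hi3 : Integrable (fun z : ℝ × ℝ × Bool => k z.2.2 * (z.2.1 - y z.2.2)) P :=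
    integrable_outcome hF fun b => by fun_prop
  have hnn : 0 ≤ᵐ[P] fun z : ℝ × ℝ × Bool =>
      c z.2.1 - c (y z.2.2) - k z.2.2 * (z.2.1 - y z.2.2) := by
    filter_upwards [ae_outcome_posterior (σ := e.signal) (d := e.certify) hF] with z hz
    by_cases h : z.2.1 = y z.2.2
    · simp [h]
    · have := hc.lt_of_ne hz (hymem z.2.2) h
      rw [← hk] at this
      simp only [Pi.zero_apply]
      linarith
  have hint : Integrable (fun z : ℝ × ℝ × Bool =>
      c z.2.1 - c (y z.2.2) - k z.2.2 * (z.2.1 - y z.2.2)) P :=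
    (hcint.sub hcint').sub hi3
  -- By `h2` the original signal costs no more than the pooled one, so the nonnegative gap between
  -- `c` and its tangents has mean zero and vanishes almost surely.
  have hz0 : ∫ z, (c z.2.1 - c (y z.2.2) - k z.2.2 * (z.2.1 - y z.2.2)) ∂P = 0 := by
    refine le_antisymm ?_ (integral_nonneg_of_ae hnn)
    have e1 := integral_sub (hcint.sub hcint') hi3
    have e2 := integral_sub hcint hcint'
    simp only [Function.comp_def, Pi.sub_apply] at e1 e2
    rw [e1, e2, h3]
    linarith
  rw [integral_eq_zero_iff_of_nonneg_ae hnn hint] at hz0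
  filter_upwards [hz0, ae_outcome_posterior (σ := e.signal) (d := e.certify) hF] with z hz hz'
  by_contra h
  have := hc.lt_of_ne hz' (hymem z.2.2) h
  rw [← hk] at this
  simp only [Pi.zero_apply] at hz
  linarith

end Pooling

/-! ### Probability of a wrong decision, and the equation for the belief -/

section Disagreement

variable {F : Measure ℝ} {σ : Signal F} {d : Kernel ℝ Bool}

/-- The event that the certification decision differs from the one that is optimal when the
state is known and certification pays from `s` on. -/
def disagree (s : ℝ) : Set (ℝ × ℝ × Bool) := {z | ¬(z.2.2 = true ↔ s ≤ z.1)}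

theorem measurableSet_disagree (s : ℝ) : MeasurableSet (disagree s) := by
  have h1 : MeasurableSet {z : ℝ × ℝ × Bool | z.2.2 = true} := measurableSet_decision true
  have h2 : MeasurableSet {z : ℝ × ℝ × Bool | s ≤ z.1} := measurable_fst measurableSet_Ici
  exact (MeasurableSet.iff h1 h2).compl

theorem loss_of_mem_disagree {α γ : ℝ} {z : ℝ × ℝ × Bool} (hz : z ∈ disagree (α + γ)) :
    loss α γ z = |z.1 - (α + γ)| := by
  have hz' : ¬(z.2.2 = true ↔ α + γ ≤ z.1) := hz
  unfold loss
  by_cases hb : z.2.2 = true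
  · have h : z.1 < α + γ := by simpa [hb] using hz'
    rw [if_pos hb, max_eq_left (by linarith), abs_of_neg (by linarith)]
    ring
  · have h : α + γ ≤ z.1 := by simpa [hb] using hz'
    rw [if_neg hb, max_eq_right (by linarith), abs_of_nonneg (by linarith)]
    ring

theorem loss_of_notMem_disagree {α γ : ℝ} {z : ℝ × ℝ × Bool} (hz : z ∉ disagree (α + γ)) :
    loss α γ z = 0 := by
  have hz' : z.2.2 = true ↔ α + γ ≤ z.1 := not_not.1 hz
  unfold loss
  by_cases hb : z.2.2 = true
  · have h := hz'.1 hb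
    rw [if_pos hb, max_eq_right (by linarith), sub_self]
  · have h : z.1 < α + γ := not_le.1 fun h => hb (hz'.2 h)
    rw [if_neg hb, max_eq_left (by linarith), sub_self]

/-- A wrong decision occurs either within `ε` of the cutoff or at a loss of at least `ε`; Markov's
inequality bounds the latter. -/
theorem measureReal_disagree_le (hF : IsPrior F) [IsMarkovKernel d] (α γ : ℝ) {ε : ℝ}
    (hε : 0 < ε) :
    (outcome σ d).real (disagree (α + γ)) ≤
      F.real (Metric.ball (α + γ) ε) + (∫ z, loss α γ z ∂(outcome σ d)) / ε := by
  have := hF.prob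
  have hsub : disagree (α + γ) ⊆
      Prod.fst ⁻¹' (Metric.ball (α + γ) ε) ∪ {z | ε ≤ loss α γ z} := by
    intro z hz
    by_cases h : z.1 ∈ Metric.ball (α + γ) ε
    · exact Or.inl h
    · right
      rw [Metric.mem_ball, Real.dist_eq, not_lt] at h
      exact h.trans_eq (loss_of_mem_disagree hz).symm
  refine (measureReal_mono hsub).trans ((measureReal_union_le _ _).trans (add_le_add ?_ ?_))
  · conv_rhs => rw [← map_outcome_fst (σ := σ) (d := d)]
    rw [map_measureReal_apply measurable_fst measurableSet_ball]
  · rw [le_div_iff₀ hε, mul_comm]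
    exact mul_meas_ge_le_integral_of_nonneg (ae_of_all _ (loss_nonneg α γ))
      (integrable_outcome hF (continuous_loss α γ)) ε

theorem measure_disagree_eq_zero (hF : IsPrior F) [IsMarkovKernel d] {α γ : ℝ}
    (h : ∫ z, loss α γ z ∂(outcome σ d) ≤ 0) : outcome σ d (disagree (α + γ)) = 0 := by
  have := hF.prob
  have h0 : (outcome σ d).real (disagree (α + γ)) ≤ 0 := by
    refine le_of_forall_pos_le_add fun δ hδ => ?_
    obtain ⟨ε, hε, hball⟩ := hF.exists_measureReal_ball_lt hδ
    refine (measureReal_disagree_le hF α γ hε).trans ?_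
    have := div_nonpos_of_nonpos_of_nonneg h hε.le
    linarith [hball (α + γ)]
  exact (measureReal_eq_zero_iff (measure_ne_top _ _)).1 (le_antisymm h0 measureReal_nonneg)

/-- The states in which the certification decision `b` is optimal, if certification pays from
`s` on. -/
def region (s : ℝ) (b : Bool) : Set ℝ := if b = true then Ici s else Iio s

theorem measurableSet_region (s : ℝ) (b : Bool) : MeasurableSet (region s b) := by
  cases b
  · exact measurableSet_Iio
  · exact measurableSet_Ici

theorem mem_region_iff {s : ℝ} {b : Bool} {z : ℝ × ℝ × Bool} (hz : z ∉ disagree s) :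
    z ∈ decision b ↔ z.1 ∈ region s b := by
  have hz' : z.2.2 = true ↔ s ≤ z.1 := not_not.1 hz
  cases b
  · show z.2.2 = false ↔ z.1 < s
    rw [← not_le, ← hz', Bool.not_eq_true]
  · exact hz'

/-- The two indicators differ only where decision and cutoff rule disagree. This replaces an
equilibrium's decisions by the cutoff rule at a controlled error. -/
theorem abs_setIntegral_sub_le (hF : IsPrior F) [IsMarkovKernel d] (s : ℝ) (b : Bool)
    {g : ℝ → ℝ} (hg : Continuous g) {C : ℝ} (hC : ∀ θ ∈ Icc (0 : ℝ) 1, |g θ| ≤ C) :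
    |(∫ z in decision b, g z.1 ∂(outcome σ d)) - ∫ θ in region s b, g θ ∂F| ≤
      C * (outcome σ d).real (disagree s) := by
  have := hF.prob
  have hint : Integrable (fun z => g z.1) (outcome σ d) :=
    integrable_outcome hF fun b => by fun_prop
  have hmr : MeasurableSet (Prod.fst ⁻¹' region s b : Set (ℝ × ℝ × Bool)) :=
    measurable_fst (measurableSet_region s b)
  have h1 : ∫ θ in region s b, g θ ∂F =
      ∫ z in Prod.fst ⁻¹' region s b, g z.1 ∂(outcome σ d) := by
    conv_lhs => rw [← map_outcome_fst (σ := σ) (d := d)]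
    exact setIntegral_map (measurableSet_region s b) hg.aestronglyMeasurable (by fun_prop)
  rw [h1, ← integral_indicator (measurableSet_decision b), ← integral_indicator hmr,
    ← integral_sub (hint.indicator (measurableSet_decision b)) (hint.indicator hmr)]
  have h2 : ∫ z, (disagree s).indicator (fun _ => C) z ∂(outcome σ d) =
      C * (outcome σ d).real (disagree s) := by
    rw [integral_indicator (measurableSet_disagree s)]
    simp [mul_comm]
  rw [← h2, ← Real.norm_eq_abs]
  refine norm_integral_le_of_norm_le ((integrable_const C).indicator (measurableSet_disagree s)) ?_
  filter_upwards [ae_outcome_state (σ := σ) (d := d) hF] with z hz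
  have hgz := hC _ (Ioo_subset_Icc_self hz)
  have hC0 : 0 ≤ C := (abs_nonneg _).trans hgz
  by_cases hd : z ∈ disagree s
  · rw [indicator_of_mem hd, Real.norm_eq_abs]
    by_cases ha : z ∈ decision b <;> by_cases hb : z ∈ (Prod.fst ⁻¹' region s b : Set (ℝ × ℝ × Bool))
    · rw [indicator_of_mem ha, indicator_of_mem hb]; simpa using hC0
    · rw [indicator_of_mem ha, indicator_of_notMem hb]; simpa using hgz
    · rw [indicator_of_notMem ha, indicator_of_mem hb]; simpa using hgz
    · rw [indicator_of_notMem ha, indicator_of_notMem hb]; simpa using hC0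
  · rw [indicator_of_notMem hd]
    by_cases ha : z ∈ decision b
    · have hb : z ∈ (Prod.fst ⁻¹' region s b : Set (ℝ × ℝ × Bool)) := (mem_region_iff hd).1 ha
      rw [indicator_of_mem ha, indicator_of_mem hb]; simp
    · have hb : z ∉ (Prod.fst ⁻¹' region s b : Set (ℝ × ℝ × Bool)) :=
        fun h => ha ((mem_region_iff hd).2 h)
      rw [indicator_of_notMem ha, indicator_of_notMem hb]; simp

theorem integral_cond_eq {P : Measure (ℝ × ℝ × Bool)} [IsFiniteMeasure P]
    (A : Set (ℝ × ℝ × Bool)) :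
    ∫ z, z.1 ∂(ProbabilityTheory.cond P A) = (P.real A)⁻¹ * ∫ z in A, z.1 ∂P := by
  rw [ProbabilityTheory.cond, integral_smul_measure, ENNReal.toReal_inv, smul_eq_mul,
    measureReal_def]

theorem setIntegral_noCert_sub (hF : IsPrior F) (e : Assessment F) (α : ℝ) :
    ∫ z in decision false, (z.1 - α) ∂e.law =
      (∫ z in noCert, z.1 ∂e.law) - α * e.law.real noCert := by
  have := hF.prob
  have := e.markov
  have hi : Integrable (fun z : ℝ × ℝ × Bool => z.1) e.law :=
    integrable_outcome_state (σ := e.signal) (d := e.certify) hF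
  have := e.isProbabilityMeasure_law hF
  rw [integral_sub hi.integrableOn (integrable_const _)]
  simp [noCert, decision, mul_comm]

/-- Bayes' rule multiplied by the probability of `m_∅`; in this form it also holds off the path. -/
theorem IsCovertEquilibrium.setIntegral_noCert (hF : IsPrior F) {c : ℝ → ℝ} {γ κ : ℝ}
    {e : Assessment F} (he : IsCovertEquilibrium c γ κ e) :
    ∫ z in decision false, (z.1 - e.belief none) ∂e.law = 0 := by
  have := e.isProbabilityMeasure_law hF
  by_cases h : e.law noCert = 0
  · have h' : e.law (decision false) = 0 := h
    rw [Measure.restrict_eq_zero.2 h', integral_zero_measure]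
  · have hb := he.belief_noCert h
    have h' : e.law.real noCert ≠ 0 := (measureReal_ne_zero_iff (measure_ne_top _ _)).2 h
    rw [integral_cond_eq] at hb
    rw [setIntegral_noCert_sub hF, hb]
    field_simp
    simp

theorem IsPrior.setIntegral_Iio_sub (hF : IsPrior F) (α s : ℝ) :
    ∫ θ in Iio s, (θ - α) ∂F = (s - α) * cdf F s - shortfall F s := by
  have := hF.prob
  have := hF.nullSingletonClass
  rw [setIntegral_congr_set (Iio_ae_eq_Iic (μ := F) (a := s)),
    integral_sub (hF.integrable_of_continuous (g := fun θ => θ) (by fun_prop)).integrableOn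
      (integrable_const _), hF.shortfall_eq_setIntegral, cdf_eq_real]
  simp
  ring

theorem IsCovertEquilibrium.belief_none_mem {c : ℝ → ℝ} {γ κ : ℝ} {e : Assessment F}
    (he : IsCovertEquilibrium c γ κ e) : e.belief none ∈ Icc (0 : ℝ) 1 :=
  he.belief_mem _ (Or.inl rfl)

/-- With `β` the belief, `θ - β` integrates to zero over `m_∅` and to `γ F(β + γ) - S(β + γ)` over
`θ < β + γ`; on `[0, 1]` it is at most `1` in absolute value. -/
theorem IsCovertEquilibrium.abs_shortfall_sub_le (hF : IsPrior F) {c : ℝ → ℝ} {γ κ : ℝ}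
    {e : Assessment F} (he : IsCovertEquilibrium c γ κ e) :
    |shortfall F (e.belief none + γ) - γ * cdf F (e.belief none + γ)| ≤
      e.law.real (disagree (e.belief none + γ)) := by
  have := e.markov
  have h := abs_setIntegral_sub_le hF (σ := e.signal) (d := e.certify) (e.belief none + γ) false
    (g := fun θ => θ - e.belief none) (by fun_prop) (C := 1) fun θ hθ => by
      have := he.belief_none_mem
      rw [abs_le]
      constructor <;> linarith [hθ.1, hθ.2, this.1, this.2]
  rw [show outcome e.signal e.certify = e.law from rfl, he.setIntegral_noCert hF] at h
  simp only [region, Bool.false_eq_true, if_false] at h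
  rw [hF.setIntegral_Iio_sub, one_mul, zero_sub, abs_neg, abs_sub_comm] at h
  simpa using h

theorem IsCovertEquilibrium.measure_disagree_of_free (hF : IsPrior F) {c : ℝ → ℝ} {γ : ℝ}
    {e : Assessment F} (he : IsCovertEquilibrium c γ 0 e) :
    e.law (disagree (e.belief none + γ)) = 0 := by
  have := e.markov
  refine measure_disagree_eq_zero hF ?_
  have h := he.integral_loss_le hF
  rw [zero_mul, he.action_none] at h
  exact h

theorem IsCovertEquilibrium.shortfall_eq_of_free (hF : IsPrior F) {c : ℝ → ℝ} {γ : ℝ}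
    {e : Assessment F} (he : IsCovertEquilibrium c γ 0 e) :
    shortfall F (e.belief none + γ) = γ * cdf F (e.belief none + γ) := by
  have h := he.abs_shortfall_sub_le hF
  rw [measureReal_def, he.measure_disagree_of_free hF, ENNReal.toReal_zero] at h
  exact sub_eq_zero.1 (abs_nonpos_iff.1 h)

end Disagreement

/-! ### The binary equilibrium and its Pareto-worst property -/

section Threshold

variable {F : Measure ℝ}

/-- `α` is a belief after `m_∅` that is consistent with certification of the states that are at
least `α + γ`. -/
structure IsThreshold (F : Measure ℝ) (γ α : ℝ) : Prop where
  cost_pos : 0 < γ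
  mem : α ∈ Ioo (0 : ℝ) 1
  lt_one : α + γ < 1
  eq : shortfall F (α + γ) = γ * cdf F (α + γ)

theorem IsPrior.measureReal_Ici_pos (hF : IsPrior F) {s : ℝ} (hs0 : 0 ≤ s) (hs : s < 1) :
    0 < F.real (Ici s) := by
  have := hF.prob
  refine ENNReal.toReal_pos (ne_of_gt ?_) (measure_ne_top _ _)
  exact (hF.measure_Ioo_pos hs0 hs le_rfl).trans_le (measure_mono fun x hx => hx.1.le)

theorem IsPrior.setIntegral_sub_condMean (hF : IsPrior F) {A : Set ℝ} (hA : F.real A ≠ 0) :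
    ∫ θ in A, (θ - condMean F A) ∂F = 0 := by
  have := hF.prob
  rw [integral_sub (hF.integrable_of_continuous (g := fun θ => θ) (by fun_prop)).integrableOn
    (integrable_const _), condMean_eq]
  simp only [integral_const, smul_eq_mul, measureReal_restrict_apply_univ]
  field_simp
  simp

theorem IsPrior.condMean_Ici_mem (hF : IsPrior F) {s : ℝ} (hs0 : 0 ≤ s) (hs : s < 1) :
    condMean F (Ici s) ∈ Icc s 1 := by
  have := hF.prob
  have hp := hF.measureReal_Ici_pos hs0 hs
  have hi := (hF.integrable_of_continuous (g := fun θ => θ) (by fun_prop)).integrableOn (s := Ici s)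
  have h1 := setIntegral_mono_on (integrable_const s).integrableOn hi measurableSet_Ici
    (fun θ hθ => hθ)
  have h2 := integral_mono_ae (μ := F.restrict (Ici s)) hi (integrable_const 1)
    (ae_restrict_of_ae (hF.ae_mem_Icc.mono fun θ hθ => hθ.2))
  simp only [integral_const, smul_eq_mul, measureReal_restrict_apply_univ, mul_one] at h1 h2
  rw [condMean_eq, mem_Icc, le_inv_mul_iff₀ hp, inv_mul_le_iff₀ hp]
  exact ⟨h1, by linarith⟩

variable {γ α : ℝ}

/-- The posterior mean of a sender who only learns whether `θ ≥ α + γ`. -/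
noncomputable def binaryMean (F : Measure ℝ) (γ α : ℝ) (θ : ℝ) : ℝ :=
  if α + γ ≤ θ then condMean F (Ici (α + γ)) else α

theorem measurable_binaryMean : Measurable (binaryMean F γ α) :=
  Measurable.ite measurableSet_Ici measurable_const measurable_const

theorem IsThreshold.condMean_Ici_mem (hF : IsPrior F) (h : IsThreshold F γ α) :
    condMean F (Ici (α + γ)) ∈ Icc (α + γ) 1 :=
  hF.condMean_Ici_mem (by linarith [h.mem.1, h.cost_pos]) h.lt_one

theorem IsThreshold.le_binaryMean_iff (hF : IsPrior F) (h : IsThreshold F γ α) (θ : ℝ) :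
    α + γ ≤ binaryMean F γ α θ ↔ α + γ ≤ θ := by
  unfold binaryMean
  split_ifs with hθ
  · exact iff_of_true (h.condMean_Ici_mem hF).1 hθ
  · exact iff_of_false (by linarith [h.cost_pos]) hθ

/-- Above the cutoff the residual integrates to zero by definition of the conditional mean, below it
by the threshold equation. -/
theorem IsThreshold.setIntegral_binaryMean (hF : IsPrior F) (h : IsThreshold F γ α)
    (B : Set ℝ) (hB : MeasurableSet B) :
    ∫ θ in binaryMean F γ α ⁻¹' B, θ ∂F =
      ∫ θ in binaryMean F γ α ⁻¹' B, binaryMean F γ α θ ∂F := by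
  classical
  have := hF.prob
  have hid : Integrable (fun θ : ℝ => θ) F := hF.integrable_of_continuous (by fun_prop)
  have hbm : Integrable (binaryMean F γ α) F := by
    refine Integrable.of_bound measurable_binaryMean.aestronglyMeasurable
      (|condMean F (Ici (α + γ))| + |α|) (ae_of_all _ fun θ => ?_)
    unfold binaryMean
    rw [Real.norm_eq_abs]
    split_ifs
    · linarith [abs_nonneg α]
    · linarith [abs_nonneg (condMean F (Ici (α + γ)))]
  have hm : MeasurableSet (binaryMean F γ α ⁻¹' B) := measurable_binaryMean hB
  rw [← sub_eq_zero, ← integral_sub hid.integrableOn hbm.integrableOn, ← integral_indicator hm]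
  have hint : Integrable ((binaryMean F γ α ⁻¹' B).indicator fun θ => θ - binaryMean F γ α θ) F :=
    (hid.sub hbm).indicator hm
  rw [← integral_add_compl (measurableSet_Ici (a := α + γ)) hint, compl_Ici]
  have h1 : ∫ θ in Ici (α + γ), (binaryMean F γ α ⁻¹' B).indicator
      (fun θ => θ - binaryMean F γ α θ) θ ∂F = ∫ θ in Ici (α + γ),
        (if condMean F (Ici (α + γ)) ∈ B then 1 else 0) * (θ - condMean F (Ici (α + γ))) ∂F := by
    refine setIntegral_congr_fun measurableSet_Ici fun θ hθ => ?_
    have hθ' : binaryMean F γ α θ = condMean F (Ici (α + γ)) := if_pos hθ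
    by_cases hb : condMean F (Ici (α + γ)) ∈ B
    · simp [indicator, hθ', hb]
    · simp [indicator, hθ', hb]
  have h2 : ∫ θ in Iio (α + γ), (binaryMean F γ α ⁻¹' B).indicator
      (fun θ => θ - binaryMean F γ α θ) θ ∂F = ∫ θ in Iio (α + γ),
        (if α ∈ B then 1 else 0) * (θ - α) ∂F := by
    refine setIntegral_congr_fun measurableSet_Iio fun θ hθ => ?_
    have hθ' : binaryMean F γ α θ = α := if_neg (not_le.2 hθ)
    by_cases hb : α ∈ B
    · simp [indicator, hθ', hb]
    · simp [indicator, hθ', hb]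
  rw [h1, h2, integral_const_mul, integral_const_mul, hF.setIntegral_sub_condMean
    (hF.measureReal_Ici_pos (by linarith [h.mem.1, h.cost_pos]) h.lt_one).ne',
    hF.setIntegral_Iio_sub, h.eq]
  ring

/-- The sender only learns whether `θ ≥ α + γ`, and certifies the good news only. -/
noncomputable def thresholdAssessment (hF : IsPrior F) (h : IsThreshold F γ α) : Assessment F :=
  haveI := hF.prob
  { signal := Signal.ofFun (binaryMean F γ α) measurable_binaryMean
      (fun θ _ => by
        have h1 := h.condMean_Ici_mem hF
        have h2 := h.mem
        have h3 := h.cost_pos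
        unfold binaryMean
        split_ifs
        · exact ⟨by linarith [h1.1, h2.1], h1.2⟩
        · exact Ioo_subset_Icc_self h2)
      (h.setIntegral_binaryMean hF)
    certify := thresholdRule (α + γ)
    markov := inferInstance
    action := fun m => m.elim α id
    belief := fun m => m.elim α id }

theorem law_thresholdAssessment (hF : IsPrior F) (h : IsThreshold F γ α) :
    (thresholdAssessment hF h).law =
      F.map (fun θ => (θ, binaryMean F γ α θ, decide (α + γ ≤ θ))) := by
  have := hF.prob
  have hm : Measurable fun z : ℝ × ℝ => (z.1, z.2, decide (α + γ ≤ z.2)) :=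
    measurable_fst.prodMk (measurable_snd.prodMk ((measurable_decide_le _).comp measurable_snd))
  have hm' : Measurable fun θ => (θ, binaryMean F γ α θ) :=
    measurable_id.prodMk measurable_binaryMean
  rw [Assessment.law, show (thresholdAssessment hF h).certify = thresholdRule (α + γ) from rfl,
    outcome_thresholdRule, show (thresholdAssessment hF h).signal.kernel =
      Kernel.deterministic (binaryMean F γ α) measurable_binaryMean from rfl,
    Measure.compProd_deterministic, Measure.map_map hm hm']
  congr 1
  ext θ : 1
  simp [h.le_binaryMean_iff hF]

theorem measurable_thresholdAssessment_map : Measurable fun θ : ℝ =>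
    (θ, binaryMean F γ α θ, decide (α + γ ≤ θ)) :=
  measurable_id.prodMk (measurable_binaryMean.prodMk (measurable_decide_le _))

theorem ae_law_thresholdAssessment (hF : IsPrior F) (h : IsThreshold F γ α) :
    ∀ᵐ z ∂(thresholdAssessment hF h).law, z ∉ disagree (α + γ) ∧
      (z.2.2 = true → z.2.1 = condMean F (Ici (α + γ))) := by
  rw [law_thresholdAssessment]
  refine (ae_map_iff measurable_thresholdAssessment_map.aemeasurable ?_).2 (ae_of_all _ fun θ => ?_)
  · refine (measurableSet_disagree _).compl.inter ?_
    have h1 : MeasurableSet {z : ℝ × ℝ × Bool | z.2.2 = true} := measurableSet_decision true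
    exact h1.imp (measurableSet_eq_fun (by fun_prop) measurable_const)
  · simp [disagree, binaryMean]
    exact fun h h' => absurd h (not_le.2 h')

theorem integral_loss_thresholdAssessment (hF : IsPrior F) (h : IsThreshold F γ α) :
    ∫ z, loss α γ z ∂(thresholdAssessment hF h).law = 0 :=
  integral_eq_zero_of_ae ((ae_law_thresholdAssessment hF h).mono fun _ hz =>
    loss_of_notMem_disagree hz.1)

/-- Its loss is zero, the least possible, so no deviation gains when information is free. -/
theorem isCovertEquilibrium_thresholdAssessment (hF : IsPrior F) (h : IsThreshold F γ α)
    (c : ℝ → ℝ) : IsCovertEquilibrium c γ 0 (thresholdAssessment hF h) := by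
  have := hF.prob
  have := (thresholdAssessment hF h).markov
  have := (thresholdAssessment hF h).isProbabilityMeasure_law hF
  refine ⟨?_, fun x _ => rfl, fun h0 => ?_, fun m _ => rfl, fun σ d hd => ?_⟩
  · rintro m (rfl | ⟨x, hx, rfl⟩)
    · exact Ioo_subset_Icc_self h.mem
    · exact hx
  · have h1 := abs_setIntegral_sub_le hF (σ := (thresholdAssessment hF h).signal)
      (d := (thresholdAssessment hF h).certify) (α + γ) false (g := fun θ => θ - α) (by fun_prop)
      (C := 1) fun θ hθ => by
        rw [abs_le]
        constructor <;> linarith [hθ.1, hθ.2, h.mem.1, h.mem.2]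
    have h2 : (thresholdAssessment hF h).law (disagree (α + γ)) = 0 := by
      have := (ae_law_thresholdAssessment hF h).mono fun z hz => hz.1
      simpa [ae_iff] using this
    change |(∫ z in decision false, (z.1 - α) ∂(thresholdAssessment hF h).law) - _| ≤
      1 * (thresholdAssessment hF h).law.real (disagree (α + γ)) at h1
    simp only [region, Bool.false_eq_true, if_false] at h1
    rw [hF.setIntegral_Iio_sub, h.eq, measureReal_def, h2, ENNReal.toReal_zero, mul_zero,
      abs_nonpos_iff, setIntegral_noCert_sub hF] at h1
    have h3 : (thresholdAssessment hF h).law.real noCert ≠ 0 :=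
      (measureReal_ne_zero_iff (measure_ne_top _ _)).2 h0
    rw [integral_cond_eq, eq_inv_mul_iff_mul_eq₀ h3]
    change _ * α = _
    linarith
  · have ha : ∀ x ∈ Icc (0 : ℝ) 1, (thresholdAssessment hF h).action (some x) = x :=
      fun _ _ => rfl
    rw [senderPayoff_eq_sub_loss hF ha, senderPayoff_eq_sub_loss hF ha, zero_mul, zero_mul]
    have h1 := integral_loss_thresholdAssessment hF h
    rw [Assessment.law] at h1
    have h2 : 0 ≤ ∫ z, loss α γ z ∂(outcome σ d) := integral_nonneg (loss_nonneg α γ)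
    rw [show (thresholdAssessment hF h).action none = α from rfl, h1]
    linarith

/-- The receiver's payoff, by how dispersed the certified posterior means are. -/
theorem IsCovertEquilibrium.receiverPayoff_of_free (hF : IsPrior F) {c : ℝ → ℝ}
    {e : Assessment F} (he : IsCovertEquilibrium c γ 0 e) (hα : e.belief none = α) (m : ℝ) :
    receiverPayoff e.signal e.certify e.action =
      (∫ z, (if z.2.2 = true then (z.2.1 - m) ^ 2 else 0) ∂e.law) -
        ∫ θ, (if α + γ ≤ θ then (m - θ) ^ 2 else (α - θ) ^ 2) ∂F := by
  have := hF.prob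
  have := e.markov
  -- Cross term in `-(x - θ)² = (x - m)² - (m - θ)² - 2 (m - x)(θ - x)`.
  have hmoment := integral_outcome_mul_sub_eq_zero hF (σ := e.signal) (d := e.certify)
    (ψ := fun x b => if b = true then 2 * (m - x) else 0)
    (fun b => by cases b <;> simp only [Bool.false_eq_true, if_true, if_false] <;> fun_prop)
  have hmeas : Measurable fun θ => if α + γ ≤ θ then (m - θ) ^ 2 else (α - θ) ^ 2 :=
    Measurable.ite measurableSet_Ici (by fun_prop) (by fun_prop)
  have h1 : ∫ θ, (if α + γ ≤ θ then (m - θ) ^ 2 else (α - θ) ^ 2) ∂F =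
      ∫ z, (if z.2.2 = true then (m - z.1) ^ 2 else (α - z.1) ^ 2) ∂e.law := by
    rw [← integral_outcome_state (σ := e.signal) (d := e.certify) hmeas]
    refine integral_congr_ae ?_
    have h0 := he.measure_disagree_of_free hF
    rw [hα] at h0
    filter_upwards [compl_mem_ae_iff.2 h0] with z hz
    have hz' : z.2.2 = true ↔ α + γ ≤ z.1 := not_not.1 hz
    simp only [hz']
  have i1 : Integrable (fun z : ℝ × ℝ × Bool => if z.2.2 = true then (z.2.1 - m) ^ 2 else 0)
      e.law := integrable_outcome hF fun b => by
    cases b <;> simp only [Bool.false_eq_true, if_true, if_false] <;> fun_prop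
  have i2 : Integrable (fun z : ℝ × ℝ × Bool =>
      if z.2.2 = true then (m - z.1) ^ 2 else (α - z.1) ^ 2) e.law :=
    integrable_outcome hF fun b => by
      cases b <;> simp only [Bool.false_eq_true, if_true, if_false] <;> fun_prop
  have i3 : Integrable (fun z : ℝ × ℝ × Bool =>
      (if z.2.2 = true then 2 * (m - z.2.1) else 0) * (z.1 - z.2.1)) e.law :=
    integrable_outcome hF fun b => by
      cases b <;> simp only [Bool.false_eq_true, if_true, if_false] <;> fun_prop
  rw [show outcome e.signal e.certify = e.law from rfl] at hmoment
  have h2 := integral_sub (i1.sub i2) i3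
  simp only [Pi.sub_apply] at h2
  rw [hmoment, sub_zero] at h2
  rw [h1, ← integral_sub i1 i2, ← h2, receiverPayoff]
  refine integral_congr_ae ?_
  filter_upwards [ae_outcome_posterior (σ := e.signal) (d := e.certify) hF] with z hz
  by_cases hb : z.2.2 = true
  · simp only [message, hb, if_true, he.action_some _ (Ioo_subset_Icc_self hz)]
    ring
  · simp only [message, hb, Bool.false_eq_true, if_false, he.action_none, hα]
    ring

theorem receiverPayoff_thresholdAssessment (hF : IsPrior F) (h : IsThreshold F γ α) (c : ℝ → ℝ) :
    receiverPayoff (thresholdAssessment hF h).signal (thresholdAssessment hF h).certify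
        (thresholdAssessment hF h).action =
      -∫ θ, (if α + γ ≤ θ then (condMean F (Ici (α + γ)) - θ) ^ 2 else (α - θ) ^ 2) ∂F := by
  rw [(isCovertEquilibrium_thresholdAssessment hF h c).receiverPayoff_of_free (α := α) hF rfl
    (condMean F (Ici (α + γ))), integral_eq_zero_of_ae, zero_sub]
  filter_upwards [ae_law_thresholdAssessment hF h] with z hz
  split_ifs with hb
  · rw [hz.2 hb, sub_self, sq, mul_zero]; rfl
  · rfl

theorem IsCovertEquilibrium.belief_eq_of_unique (hF : IsPrior F)
    (huniq : ∀ β ∈ Icc (0 : ℝ) 1, shortfall F (β + γ) = γ * cdf F (β + γ) → β = α) {c : ℝ → ℝ}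
    {e : Assessment F} (he : IsCovertEquilibrium c γ 0 e) : e.belief none = α :=
  huniq _ he.belief_none_mem (he.shortfall_eq_of_free hF)

/-- The sender's payoffs coincide: belief `α`, no loss, no cost. The receiver gains from dispersion
of certified posterior means, and here there is none. -/
theorem isParetoWorstFree_thresholdAssessment (hF : IsPrior F) (h : IsThreshold F γ α)
    (huniq : ∀ β ∈ Icc (0 : ℝ) 1, shortfall F (β + γ) = γ * cdf F (β + γ) → β = α) (c : ℝ → ℝ) :
    IsParetoWorstFree c γ (thresholdAssessment hF h) := by
  refine ⟨isCovertEquilibrium_thresholdAssessment hF h c, fun e' he' => ⟨?_, ?_⟩⟩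
  · have := (thresholdAssessment hF h).markov
    have := e'.markov
    have hα := he'.belief_eq_of_unique hF huniq
    rw [senderPayoff_eq_sub_loss hF fun _ _ => rfl, senderPayoff_eq_sub_loss hF he'.action_some,
      zero_mul, zero_mul, he'.action_none, hα,
      show (thresholdAssessment hF h).action none = α from rfl]
    have h1 := integral_loss_thresholdAssessment hF h
    have h2 := he'.integral_loss_le hF
    rw [zero_mul, he'.action_none, hα] at h2
    rw [Assessment.law] at h1 h2
    linarith
  · rw [receiverPayoff_thresholdAssessment hF h c, he'.receiverPayoff_of_free hF
      (he'.belief_eq_of_unique hF huniq) (condMean F (Ici (α + γ)))]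
    have : 0 ≤ ∫ z, (if z.2.2 = true then (z.2.1 - condMean F (Ici (α + γ))) ^ 2 else 0) ∂e'.law :=
      integral_nonneg fun z => by
        dsimp only
        split_ifs
        · exact sq_nonneg _
        · exact le_rfl
    linarith

/-- Compared with the binary equilibrium, the receiver's payoff forces the mean squared deviation of
certified posterior means to vanish. -/
theorem IsParetoWorstFree.ae_eq (hF : IsPrior F) (h : IsThreshold F γ α)
    (huniq : ∀ β ∈ Icc (0 : ℝ) 1, shortfall F (β + γ) = γ * cdf F (β + γ) → β = α) {c : ℝ → ℝ}
    {e : Assessment F} (he : IsParetoWorstFree c γ e) :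
    ∀ᵐ z ∂e.law, (z.2.2 = true ↔ α + γ ≤ z.1) ∧
      (z.2.2 = true → z.2.1 = condMean F (Ici (α + γ))) := by
  have := e.markov
  have hα := he.1.belief_eq_of_unique hF huniq
  have h1 := (he.2 _ (isCovertEquilibrium_thresholdAssessment hF h c)).2
  rw [receiverPayoff_thresholdAssessment hF h c, he.1.receiverPayoff_of_free hF hα
    (condMean F (Ici (α + γ)))] at h1
  have hnn : 0 ≤ fun z : ℝ × ℝ × Bool =>
      if z.2.2 = true then (z.2.1 - condMean F (Ici (α + γ))) ^ 2 else 0 := fun z => by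
    dsimp only
    split_ifs
    · exact sq_nonneg _
    · exact le_rfl
  have hi : Integrable (fun z : ℝ × ℝ × Bool =>
      if z.2.2 = true then (z.2.1 - condMean F (Ici (α + γ))) ^ 2 else 0) e.law :=
    integrable_outcome hF fun b => by
      cases b <;> simp only [Bool.false_eq_true, if_true, if_false] <;> fun_prop
  have h2 := (integral_eq_zero_iff_of_nonneg hnn hi).1
    (le_antisymm (by linarith) (integral_nonneg hnn))
  have h0 := he.1.measure_disagree_of_free hF
  rw [hα] at h0
  filter_upwards [h2, compl_mem_ae_iff.2 h0] with z hz hz'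
  refine ⟨not_not.1 hz', fun hb => ?_⟩
  simp only [hb, if_true, Pi.zero_apply] at hz
  exact sub_eq_zero.1 (pow_eq_zero_iff two_ne_zero |>.1 hz)

end Threshold

/-! ### Vanishing information costs -/

section Convergence

variable {F : Measure ℝ} {γ α : ℝ} {e : ℕ → Assessment F}

theorem loss_le_add (α β γ : ℝ) (z : ℝ × ℝ × Bool) :
    loss α γ z ≤ loss β γ z + 2 * |β - α| := by
  have h1 : max α (z.1 - γ) ≤ max β (z.1 - γ) + |β - α| := by
    have := abs_max_sub_max_le_abs α β (z.1 - γ)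
    rw [abs_sub_comm α β] at this
    linarith [le_abs_self (max α (z.1 - γ) - max β (z.1 - γ))]
  have h2 := le_abs_self (β - α)
  have h3 := abs_nonneg (β - α)
  unfold loss
  split_ifs <;> linarith

theorem tendsto_measureReal_disagree (hF : IsPrior F) {a : ℕ → ℝ}
    (h : Tendsto (fun n => ∫ z, loss (a n) γ z ∂(e n).law) atTop (𝓝 0)) :
    Tendsto (fun n => (e n).law.real (disagree (a n + γ))) atTop (𝓝 0) := by
  rw [Metric.tendsto_atTop]
  intro δ hδ
  obtain ⟨ε, hε, hball⟩ := hF.exists_measureReal_ball_lt (half_pos hδ)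
  obtain ⟨N, hN⟩ := Metric.tendsto_atTop.1 h (ε * (δ / 2)) (by positivity)
  refine ⟨N, fun n hn => ?_⟩
  have := (e n).markov
  have h1 := hN n hn
  have h2 := measureReal_disagree_le hF (σ := (e n).signal) (d := (e n).certify) (a n) γ hε
  rw [Real.dist_eq, sub_zero, abs_lt] at h1
  rw [Real.dist_eq, sub_zero, abs_of_nonneg measureReal_nonneg]
  have h3 : (∫ z, loss (a n) γ z ∂(e n).law) / ε < δ / 2 := by
    rw [div_lt_iff₀ hε]
    linarith [h1.2]
  have h4 := hball (a n + γ)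
  change (e n).law.real (disagree (a n + γ)) ≤ _ + (∫ z, loss (a n) γ z ∂(e n).law) / ε at h2
  linarith

theorem tendsto_integral_loss (hF : IsPrior F) {m : ℝ} {c : ℝ → ℝ} (hc : IsCost m c)
    {κ : ℕ → ℝ} (hκ : ∀ n, 0 < κ n) (hκ0 : Tendsto κ atTop (𝓝 0))
    (he : ∀ n, IsCovertEquilibrium c γ (κ n) (e n)) :
    Tendsto (fun n => ∫ z, loss ((e n).belief none) γ z ∂(e n).law) atTop (𝓝 0) := by
  obtain ⟨B, hB⟩ := hc.bounded
  have h : Tendsto (fun n => κ n * (2 * B)) atTop (𝓝 0) := by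
    simpa using hκ0.mul_const (2 * B)
  refine squeeze_zero (fun n => integral_nonneg (loss_nonneg _ _)) (fun n => ?_) h
  have := (he n).integral_loss_le_mul hF hB (hκ n).le
  rwa [(he n).action_none] at this

theorem tendsto_belief_none (hF : IsPrior F)
    (huniq : ∀ β ∈ Icc (0 : ℝ) 1, shortfall F (β + γ) = γ * cdf F (β + γ) → β = α)
    {c : ℝ → ℝ} {κ : ℕ → ℝ} (he : ∀ n, IsCovertEquilibrium c γ (κ n) (e n))
    (hloss : Tendsto (fun n => ∫ z, loss ((e n).belief none) γ z ∂(e n).law) atTop (𝓝 0)) :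
    Tendsto (fun n => (e n).belief none) atTop (𝓝 α) := by
  have hH : Continuous fun β => shortfall F (β + γ) - γ * cdf F (β + γ) :=
    (hF.continuous_shortfall.comp (by fun_prop)).sub
      ((hF.continuous_cdf.comp (by fun_prop)).const_mul γ)
  have h0 : Tendsto (fun n => shortfall F ((e n).belief none + γ) -
      γ * cdf F ((e n).belief none + γ)) atTop (𝓝 0) :=
    squeeze_zero_norm (fun n => (he n).abs_shortfall_sub_le hF)
      (tendsto_measureReal_disagree hF hloss)
  -- By continuity, every cluster point of the beliefs in `[0, 1]` solves the threshold equation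
  -- exactly.
  refine isCompact_Icc.tendsto_nhds_of_unique_mapClusterPt
    (Eventually.of_forall fun n => (he n).belief_none_mem) fun β hβ hclus => huniq β hβ ?_
  have h1 : MapClusterPt (shortfall F (β + γ) - γ * cdf F (β + γ)) atTop
      (fun n => shortfall F ((e n).belief none + γ) - γ * cdf F ((e n).belief none + γ)) :=
    hclus.continuousAt_comp hH.continuousAt
  have h2 : ClusterPt (shortfall F (β + γ) - γ * cdf F (β + γ)) (𝓝 (0 : ℝ)) :=
    ClusterPt.mono h1 h0
  exact sub_eq_zero.1 (eq_of_nhds_neBot h2)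

/-- Passes from the moving cutoffs to the limiting one: the loss is Lipschitz in the action after
`m_∅`, so it also vanishes when computed at `α`. -/
theorem tendsto_measureReal_disagree_of_tendsto (hF : IsPrior F)
    (hα : Tendsto (fun n => (e n).belief none) atTop (𝓝 α))
    (hloss : Tendsto (fun n => ∫ z, loss ((e n).belief none) γ z ∂(e n).law) atTop (𝓝 0)) :
    Tendsto (fun n => (e n).law.real (disagree (α + γ))) atTop (𝓝 0) := by
  refine tendsto_measureReal_disagree (a := fun _ => α) hF ?_
  have h : Tendsto (fun n => (∫ z, loss ((e n).belief none) γ z ∂(e n).law) +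
      2 * |(e n).belief none - α|) atTop (𝓝 0) := by
    simpa using hloss.add ((hα.sub_const α).abs.const_mul 2)
  refine squeeze_zero (fun n => integral_nonneg (loss_nonneg _ _)) (fun n => ?_) h
  have := (e n).markov
  have := (e n).isProbabilityMeasure_law hF
  have hi : ∀ β, Integrable (loss β γ) (e n).law := fun β =>
    integrable_outcome hF (continuous_loss β γ)
  have h1 := integral_mono (hi α) ((hi ((e n).belief none)).add (integrable_const
    (2 * |(e n).belief none - α|))) (loss_le_add α ((e n).belief none) γ)
  simp only [Pi.add_apply] at h1
  rw [integral_add (hi _) (integrable_const _)] at h1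
  simpa using h1

/-- The integrands vary with `n` because a test function is later evaluated at the `n`-th pooled
means; dominated convergence under `F` handles this once the decisions are replaced by the cutoff
rule. -/
theorem tendsto_setIntegral_decision (hF : IsPrior F) {s : ℝ}
    (hdis : Tendsto (fun n => (e n).law.real (disagree s)) atTop (𝓝 0)) (b : Bool)
    {g : ℕ → ℝ → ℝ} (hg : ∀ n, Continuous (g n)) {g' : ℝ → ℝ} {C : ℝ}
    (hC : ∀ n, ∀ θ ∈ Icc (0 : ℝ) 1, |g n θ| ≤ C)
    (hlim : ∀ θ, Tendsto (fun n => g n θ) atTop (𝓝 (g' θ))) :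
    Tendsto (fun n => ∫ z in decision b, g n z.1 ∂(e n).law) atTop
      (𝓝 (∫ θ in region s b, g' θ ∂F)) := by
  have := hF.prob
  have h1 : Tendsto (fun n => ∫ θ in region s b, g n θ ∂F) atTop
      (𝓝 (∫ θ in region s b, g' θ ∂F)) :=
    tendsto_integral_of_dominated_convergence (fun _ => C)
      (fun n => (hg n).aestronglyMeasurable) (integrable_const C)
      (fun n => ae_restrict_of_ae (hF.ae_mem_Icc.mono (hC n))) (ae_of_all _ hlim)
  have h2 : Tendsto (fun n => (∫ z in decision b, g n z.1 ∂(e n).law) -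
      ∫ θ in region s b, g n θ ∂F) atTop (𝓝 0) := by
    refine squeeze_zero_norm (a := fun n => C * (e n).law.real (disagree s)) (fun n => ?_)
      (by simpa using hdis.const_mul C)
    have := (e n).markov
    exact abs_setIntegral_sub_le hF s b (hg n) (hC n)
  simpa using h2.add h1

theorem tendsto_decisionMean (hF : IsPrior F) {s : ℝ}
    (hdis : Tendsto (fun n => (e n).law.real (disagree s)) atTop (𝓝 0)) (b : Bool)
    (hs : F.real (region s b) ≠ 0) :
    Tendsto (fun n => decisionMean (e n).law b) atTop (𝓝 (condMean F (region s b))) := by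
  have := hF.prob
  have h1 := tendsto_setIntegral_decision hF hdis b (g := fun _ θ => θ) (g' := fun θ => θ) (C := 1)
    (fun _ => continuous_id) (fun _ θ hθ => abs_le.2 ⟨by linarith [hθ.1], hθ.2⟩)
    (fun θ => tendsto_const_nhds)
  have h2 := tendsto_setIntegral_decision hF hdis b (g := fun _ _ => 1) (g' := fun _ => 1) (C := 1)
    (fun _ => continuous_const) (fun _ θ _ => by simp) (fun θ => tendsto_const_nhds)
  simp only [integral_const, smul_eq_mul, measureReal_restrict_apply_univ, mul_one] at h2
  rw [condMean_eq, ← div_eq_inv_mul]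
  refine (h1.div h2 hs).congr' ?_
  filter_upwards [h2.eventually_ne hs] with n hn
  rw [decisionMean, if_neg hn]
  rfl

theorem setIntegral_law_eq {P : Measure (ℝ × ℝ × Bool)}
    (hP : ∀ᵐ z ∂P, z.2.1 = decisionMean P z.2.2) (f : ℝ × ℝ × Bool → ℝ) (b : Bool) :
    ∫ z in decision b, f z ∂P = ∫ z in decision b, f (z.1, decisionMean P b, b) ∂P := by
  refine setIntegral_congr_ae (measurableSet_decision b) ?_
  filter_upwards [hP] with z hz hb
  have hb' : z.2.2 = b := hb
  rw [hb'] at hz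
  rw [← hz, ← hb']

theorem IsThreshold.condMean_region (hF : IsPrior F) (h : IsThreshold F γ α) :
    condMean F (region (α + γ) false) = α ∧ F.real (region (α + γ) false) ≠ 0 := by
  have := hF.prob
  have := hF.nullSingletonClass
  have h1 : F.real (Iio (α + γ)) = cdf F (α + γ) := by
    rw [cdf_eq_real]
    exact measureReal_congr (Iio_ae_eq_Iic (μ := F) (a := α + γ))
  have h2 := hF.cdf_pos (t := α + γ) (by linarith [h.mem.1, h.cost_pos])
  have h3 := hF.setIntegral_Iio_sub 0 (α + γ)
  simp only [sub_zero] at h3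
  simp only [region, Bool.false_eq_true, if_false]
  refine ⟨?_, by rw [h1]; exact h2.ne'⟩
  rw [condMean_eq, h1, h3, h.eq]
  field_simp
  ring

theorem integral_law_thresholdAssessment (hF : IsPrior F) (h : IsThreshold F γ α)
    {f : ℝ × ℝ × Bool → ℝ} (hf : Continuous f) {C : ℝ} (hC : ∀ z, |f z| ≤ C) :
    ∫ z, f z ∂(thresholdAssessment hF h).law =
      (∫ θ in region (α + γ) true, f (θ, condMean F (region (α + γ) true), true) ∂F) +
        ∫ θ in region (α + γ) false, f (θ, condMean F (region (α + γ) false), false) ∂F := by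
  have := hF.prob
  have hm := measurable_thresholdAssessment_map (F := F) (γ := γ) (α := α)
  have hi : Integrable (fun θ => f (θ, binaryMean F γ α θ, decide (α + γ ≤ θ))) F :=
    Integrable.of_bound (hf.measurable.comp hm).aestronglyMeasurable C (ae_of_all _ fun θ => hC _)
  rw [law_thresholdAssessment, integral_map hm.aemeasurable hf.aestronglyMeasurable,
    ← integral_add_compl (measurableSet_region (α + γ) true) hi, (h.condMean_region hF).1]
  have hcompl : (region (α + γ) true)ᶜ = region (α + γ) false := by simp [region]
  rw [hcompl]
  congr 1
  · refine setIntegral_congr_fun (measurableSet_region _ _) fun θ hθ => ?_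
    have hθ' : α + γ ≤ θ := hθ
    simp [binaryMean, region, hθ']
  · refine setIntegral_congr_fun (measurableSet_region _ _) fun θ hθ => ?_
    have hθ' : ¬α + γ ≤ θ := not_le.2 hθ
    simp [binaryMean, hθ']

/-- Given the decision, the posterior mean is a constant that converges, so a bounded continuous
test function becomes a function of the state alone on each decision event. -/
theorem tendsto_lawP (hF : IsPrior F) (h : IsThreshold F γ α)
    (hdis : Tendsto (fun n => (e n).law.real (disagree (α + γ))) atTop (𝓝 0))
    (hpost : ∀ n, ∀ᵐ z ∂(e n).law, z.2.1 = decisionMean (e n).law z.2.2) :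
    Tendsto (fun n => (e n).lawP hF) atTop (𝓝 ((thresholdAssessment hF h).lawP hF)) := by
  rw [ProbabilityMeasure.tendsto_iff_forall_integral_tendsto]
  intro f
  change Tendsto (fun n => ∫ z, f z ∂(e n).law) atTop
    (𝓝 (∫ z, f z ∂(thresholdAssessment hF h).law))
  have hC : ∀ z, |f z| ≤ ‖f‖ := fun z => f.norm_coe_le_norm z
  have hpos : ∀ b, F.real (region (α + γ) b) ≠ 0 := by
    intro b
    cases b
    · exact (h.condMean_region hF).2
    · exact (hF.measureReal_Ici_pos (by linarith [h.mem.1, h.cost_pos]) h.lt_one).ne'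
  have key : ∀ b, Tendsto (fun n => ∫ z in decision b, f z ∂(e n).law) atTop
      (𝓝 (∫ θ in region (α + γ) b, f (θ, condMean F (region (α + γ) b), b) ∂F)) := by
    intro b
    simp only [fun n => setIntegral_law_eq (hpost n) f b]
    refine tendsto_setIntegral_decision hF hdis b
      (g := fun n θ => f (θ, decisionMean (e n).law b, b)) (C := ‖f‖)
      (fun n => f.continuous.comp (by fun_prop)) (fun n θ _ => hC _) fun θ => ?_
    exact (f.continuous.tendsto _).comp (tendsto_const_nhds.prodMk_nhds
      ((tendsto_decisionMean hF hdis b (hpos b)).prodMk_nhds tendsto_const_nhds))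
  rw [integral_law_thresholdAssessment hF h f.continuous hC]
  refine ((key true).add (key false)).congr fun n => ?_
  have := (e n).isProbabilityMeasure_law hF
  exact (integral_eq_add_decision (Integrable.of_bound f.continuous.aestronglyMeasurable ‖f‖
    (ae_of_all _ hC))).symm

end Convergence

end Evidence

theorem theorem2 (F : Measure ℝ) (hF : Evidence.IsPrior F)
    (c : ℝ → ℝ) (hc : Evidence.IsCost (Evidence.priorMean F) c)
    (γ : ℝ) (hγ0 : 0 < γ) (hγ1 : γ < 1 - Evidence.priorMean F) :
    ∃ (αs : ℝ) (es : Evidence.Assessment F),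
      -- `αs` is the unique solution of `α = E[θ | θ ≤ α + γ]`
      (αs ∈ Ioo (0 : ℝ) 1 ∧ αs + γ < 1 ∧ αs = Evidence.condMean F (Iic (αs + γ)) ∧
        ∀ α ∈ Icc (0 : ℝ) 1, α = Evidence.condMean F (Iic (α + γ)) → α = αs) ∧
      -- in `es` the sender learns only whether `θ ≥ αs + γ`, and certifies the good news only
      (∀ θ ∈ Icc (0 : ℝ) 1, es.signal.kernel θ =
        Measure.dirac (if αs + γ ≤ θ then Evidence.condMean F (Ici (αs + γ)) else αs)) ∧
      (∀ x ∈ Icc (0 : ℝ) 1, es.certify x {true} = if αs + γ ≤ x then 1 else 0) ∧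
      es.belief none = αs ∧
      -- `es` is a Pareto-worst free-learning equilibrium
      Evidence.IsParetoWorstFree c γ es ∧
      -- any other one differs from `es` only in the posterior means that are not certified
      (∀ e : Evidence.Assessment F, Evidence.IsParetoWorstFree c γ e →
        e.belief none = αs ∧
        ∀ᵐ z ∂e.law, (z.2.2 = true ↔ αs + γ ≤ z.1) ∧
          (z.2.2 = true → z.2.1 = Evidence.condMean F (Ici (αs + γ)))) ∧
      -- all sequences of covert equilibria converge to `es` as the cost scale vanishes
      (∀ (κ : ℕ → ℝ) (e : ℕ → Evidence.Assessment F), (∀ n, 0 < κ n) →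
        Tendsto κ atTop (𝓝 0) → (∀ n, Evidence.IsCovertEquilibrium c γ (κ n) (e n)) →
        Tendsto (fun n => (e n).lawP hF) atTop (𝓝 (es.lawP hF)) ∧
        Tendsto (fun n => (e n).belief none) atTop (𝓝 (es.belief none)) ∧
        Tendsto (fun n => (e n).action none) atTop (𝓝 (es.action none))) := by
  obtain ⟨α, hα, hα1, hαeq, huniq⟩ := hF.exists_threshold hγ0 hγ1
  have h : Evidence.IsThreshold F γ α :=
    ⟨hγ0, hα, hα1, (hF.eq_condMean_iff (by linarith [hα.1])).1 hαeq⟩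
  refine ⟨α, Evidence.thresholdAssessment hF h, ⟨hα, hα1, hαeq, fun β hβ hβeq =>
    huniq β hβ ((hF.eq_condMean_iff (by linarith [hβ.1])).1 hβeq)⟩, fun θ _ => ?_, fun x _ => ?_,
    rfl, Evidence.isParetoWorstFree_thresholdAssessment hF h huniq c, fun e he =>
      ⟨he.1.belief_eq_of_unique hF huniq, he.ae_eq hF h huniq⟩, fun κ e hκ hκ0 he => ?_⟩
  · exact Kernel.deterministic_apply Evidence.measurable_binaryMean θ
  · change Evidence.thresholdRule (α + γ) x {true} = _
    rw [Evidence.thresholdRule, Kernel.deterministic_apply,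
      Measure.dirac_apply' _ (measurableSet_singleton _)]
    simp [indicator]
  · have hloss := Evidence.tendsto_integral_loss hF hc hκ hκ0 he
    have hbelief := Evidence.tendsto_belief_none hF huniq he hloss
    refine ⟨Evidence.tendsto_lawP hF h
      (Evidence.tendsto_measureReal_disagree_of_tendsto hF hbelief hloss)
      (fun n => (he n).posterior_eq hF hc (hκ n)), hbelief, ?_⟩
    simp only [fun n => (he n).action_none]
    exact hbelief
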